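/- Let $(W,S)$ be a finite Coxeter group with simple reflections $s_i$ ($i\in S$) and length function $\ell$, and let $\delta: W\to W$ be a group automorphism sending simple reflections to simple reflections. Let $\langle\delta\rangle$ be the cyclic subgroup of $\mathrm{Aut}(W)$ generated by $\delta$, set $\tilde W=\langle\delta\rangle\ltimes W$, and extend the length to $\tilde W$ by $\ell(\delta^k w)=\ell(w)$ for $k\in\mathbb Z$, $w\in W$. For $\tilde w,\tilde w'\in\tilde W$ write $\tilde w\to\tilde w'$ if there is a sequence $\tilde w=\tilde w_0,\tilde w_1,\dots,\tilde w_n=\tilde w'$ ($n\ge 0$) in $\tilde W$ such that for each $1\le k\le n$ there is $i\in S$ with $\tilde w_k=s_i\tilde w_{k-1}s_i$ and $\ell(\tilde w_k)\le\ell(\tilde w_{k-1})$. Call $\tilde w,\tilde w'\in\tilde W$ elementarily strongly conjugate if $\ell(\tilde w)=\ell(\tilde w')$ and there is $x\in W$ with $\tilde w'=x\tilde wx^{-1}$ and either $\ell(x\tilde w)=\ell(x)+\ell(\tilde w)$ or $\ell(\tilde wx^{-1})=\ell(x)+\ell(\tilde w)$. Call $\tilde w,\tilde w'$ strongly conjugate,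 written $\tilde w\sim\tilde w'$, if there is a sequence $\tilde w=\tilde w_0,\dots,\tilde w_n=\tilde w'$ ($n\ge 0$) in $\tilde W$ with $\tilde w_{k-1}$ elementarily strongly conjugate to $\tilde w_k$ for each $1\le k\le n$. Let $\mathcal O=\{x\tilde w_0x^{-1} : x\in W\}$, with $\tilde w_0\in\tilde W$, be a $W$-conjugacy class in $\tilde W$, and let $\mathcal O_{\min}$ be the set of elements of minimal length in $\mathcal O$. Then: (1) For each $\tilde w\in\mathcal O$ there exists $\tilde w'\in\mathcal O_{\min}$ such that $\tilde w\to\tilde w'$. (2) For all $\tilde w,\tilde w'\in\mathcal O_{\min}$, $\tilde w\sim\tilde w'$. -/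

import Mathlib

namespace TwistedCoxeter

/-- The group `⟨δ⟩ ⋉ W`, where `⟨δ⟩` is the cyclic subgroup of `Aut W` generated by `δ`. -/
abbrev Ext {W : Type*} [Group W] (δ : MulAut W) : Type _ :=
  W ⋊[(Subgroup.zpowers δ).subtype] (Subgroup.zpowers δ)

/-- The embedding of `W` in `⟨δ⟩ ⋉ W`. -/
abbrev incl {W : Type*} [Group W] (δ : MulAut W) : W →* Ext δ := SemidirectProduct.inl

/-- `δ` sends simple reflections to simple reflections. -/
def IsDiagramAut {B : Type*} {M : CoxeterMatrix B} {W : Type*} [Group W]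
    (cs : CoxeterSystem M W) (δ : MulAut W) : Prop :=
  ∀ i : B, ∃ j : B, δ (cs.simple i) = cs.simple j

section

variable {B : Type*} {M : CoxeterMatrix B} {W : Type*} [Group W]
  (cs : CoxeterSystem M W) {δ : MulAut W}

/-- The length on `⟨δ⟩ ⋉ W`: if `w = γ v` with `γ ∈ ⟨δ⟩` and `v ∈ W`, then `ℓ w = ℓ v`. Here `γ` is
the component `w.right` and `v = γ⁻¹ w`. -/
noncomputable def len (w : Ext δ) : ℕ :=
  cs.length ((SemidirectProduct.inr w.right)⁻¹ * w).left

/-- `ℓ(γ v) = ℓ(v)` for `γ ∈ ⟨δ⟩` and `v ∈ W`. -/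
theorem len_inr_mul_inl (γ : Subgroup.zpowers δ) (v : W) :
    len cs (SemidirectProduct.inr γ * SemidirectProduct.inl v : Ext δ) = cs.length v := by
  simp [len]

/-- `w → w'` in one step: `w' = s_i w s_i` for some `i`, and `ℓ(w') ≤ ℓ(w)`. -/
def Step (w w' : Ext δ) : Prop :=
  ∃ i : B, w' = incl δ (cs.simple i) * w * incl δ (cs.simple i) ∧ len cs w' ≤ len cs w

/-- `w → w'`: a finite (possibly empty) chain of steps leads from `w` to `w'`. -/
def Reduces (w w' : Ext δ) : Prop :=
  Relation.ReflTransGen (Step cs) w w'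

/-- Elementary strong conjugacy in `⟨δ⟩ ⋉ W`; the conjugating element lies in `W`. -/
def ElemStrongConj (w w' : Ext δ) : Prop :=
  len cs w = len cs w' ∧ ∃ x : W, w' = incl δ x * w * (incl δ x)⁻¹ ∧
    (len cs (incl δ x * w) = cs.length x + len cs w ∨
      len cs (w * (incl δ x)⁻¹) = cs.length x + len cs w)

/-- Strong conjugacy: a finite chain of elementary strong conjugacies. -/
def StrongConj (w w' : Ext δ) : Prop :=
  Relation.ReflTransGen (ElemStrongConj cs) w w'

/-- The set of elements of minimal length in `O`. -/
def minLength (O : Set (Ext δ)) : Set (Ext δ) :=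
  {w | w ∈ O ∧ ∀ u ∈ O, len cs w ≤ len cs u}

end

/-- `O` is a `W`-conjugacy class in `⟨δ⟩ ⋉ W`. -/
def IsWConjClass {W : Type*} [Group W] {δ : MulAut W} (O : Set (Ext δ)) : Prop :=
  ∃ w : Ext δ, O = {y | ∃ x : W, y = incl δ x * w * (incl δ x)⁻¹}

end TwistedCoxeter

/-! Realize the roots in a Euclidean space with base chamber C. The number of root hyperplanes
separating xC from wxC is ℓ(x⁻¹wx), so conjugates of w correspond to chambers and lengths to
displacements of chambers under the isometry g given by w. Simple conjugations become wall
crossings; elementary strong conjugations come from moves along geodesics. The theorem thus reduces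
to `minimal_displacement`, about an isometry preserving a finite central arrangement.

That statement is proved by induction on the number of roots, using the symmetric operator T = g +
g⁻¹ on the span E of the roots. Suppose v lies in the closure of a chamber and in a wall α, positive
on the chamber, with ⟪α, Tv⟫ < 0. Then α is negative on the image of the chamber under g or g⁻¹, so
crossing the wall does not increase the displacement. Motion in the direction Tv is therefore
permitted, and it leads to the eigenspace K of the largest eigenvalue μ of T on E; `exists_goodAt`
obtains the limit by maximization over a compact set.

Inside K, at a point h of a wall β, ⟪β, gh⟫ + ⟪β, g⁻¹h⟫ = μ⟪β, h⟫ = 0. Hence gh and g⁻¹h lie on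
opposite sides of β or both on it, and the crossing preserves displacement and is geodesic unless g
= -1 on E (`exists_link_goodAt`); for g = -1 every crossing is allowed. Chambers around one generic
point of K are separated only by hyperplanes containing K, the others contributing a constant to the
displacement, so induction applies to the roots orthogonal to K.

The algebraic input is positivity of roots (`geom_root_nonneg`), which identifies separation with
length. Sending x to the coordinates of all gx makes the extended group act by coordinate
permutations, so the Euclidean structure comes without proving the invariant form definite. -/

open scoped RealInnerProductSpace Topology

/-! ### Counting separating hyperplanes in a finite central arrangement. -/

namespace Arrangement

variable {V : Type*} [NormedAddCommGroup V] [InnerProductSpace ℝ V]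

/-- `p` lies on none of the hyperplanes orthogonal to the vectors of `Φ`. -/
def Regular (Φ : Finset V) (p : V) : Prop := ∀ α ∈ Φ, ⟪α, p⟫ ≠ 0

open Classical in
/-- The vectors of `Φ` that are positive at `p` and negative at `q`. -/
noncomputable def sep (Φ : Finset V) (p q : V) : Finset V :=
  Φ.filter fun α => 0 < ⟪α, p⟫ ∧ ⟪α, q⟫ < 0

/-- The number of vectors of `Φ` that are positive at `p` and negative at `q`. -/
noncomputable def gap (Φ : Finset V) (p q : V) : ℕ := (sep Φ p q).card

/-- `p` and `q` lie on the same side of the hyperplane orthogonal to `α`. -/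
def SameSide (α p q : V) : Prop := 0 < ⟪α, p⟫ * ⟪α, q⟫

theorem mem_sep {Φ : Finset V} {p q α : V} :
    α ∈ sep Φ p q ↔ α ∈ Φ ∧ 0 < ⟪α, p⟫ ∧ ⟪α, q⟫ < 0 := by
  simp [sep]

theorem SameSide.pos_iff {α p q : V} (h : SameSide α p q) : 0 < ⟪α, p⟫ ↔ 0 < ⟪α, q⟫ := by
  unfold SameSide at h
  rcases mul_pos_iff.1 h with ⟨h1, h2⟩ | ⟨h1, h2⟩
  · exact ⟨fun _ => h2, fun _ => h1⟩
  · exact ⟨fun h => absurd h h1.not_gt, fun h => absurd h h2.not_gt⟩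

theorem SameSide.neg_iff {α p q : V} (h : SameSide α p q) : ⟪α, p⟫ < 0 ↔ ⟪α, q⟫ < 0 := by
  unfold SameSide at h
  rcases mul_pos_iff.1 h with ⟨h1, h2⟩ | ⟨h1, h2⟩
  · exact ⟨fun h => absurd h h1.not_gt, fun h => absurd h h2.not_gt⟩
  · exact ⟨fun _ => h2, fun _ => h1⟩

theorem SameSide.symm {α p q : V} (h : SameSide α p q) : SameSide α q p := by
  unfold SameSide at *; rwa [mul_comm]

theorem SameSide.ne_left {α p q : V} (h : SameSide α p q) : ⟪α, p⟫ ≠ 0 := by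
  unfold SameSide at h; exact left_ne_zero_of_mul h.ne'

theorem SameSide.ne_right {α p q : V} (h : SameSide α p q) : ⟪α, q⟫ ≠ 0 := h.symm.ne_left

theorem SameSide.trans {α p q r : V} (h : SameSide α p q) (h' : SameSide α q r) :
    SameSide α p r := by
  rcases lt_or_gt_of_ne h.ne_left with h1 | h1
  · exact mul_pos_of_neg_of_neg h1 (h'.neg_iff.1 (h.neg_iff.1 h1))
  · exact mul_pos h1 (h'.pos_iff.1 (h.pos_iff.1 h1))

theorem sameSide_self {α p : V} (h : ⟪α, p⟫ ≠ 0) : SameSide α p p := mul_self_pos.2 h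

theorem sameSide_map (g : V ≃ₗᵢ[ℝ] V) {α p q : V} :
    SameSide α (g p) (g q) ↔ SameSide (g.symm α) p q := by
  have (r : V) : ⟪α, g r⟫ = ⟪g.symm α, r⟫ := by
    rw [← g.inner_map_map (g.symm α) r]; simp
  simp [SameSide, this]

theorem inner_map_right (g : V ≃ₗᵢ[ℝ] V) (α r : V) : ⟪α, g r⟫ = ⟪g.symm α, r⟫ := by
  rw [← g.inner_map_map (g.symm α) r]; simp

theorem inner_symm_right (g : V ≃ₗᵢ[ℝ] V) (α r : V) : ⟪α, g.symm r⟫ = ⟪g α, r⟫ := by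
  rw [← g.inner_map_map α]; simp

section

variable {Φ : Finset V}

theorem Regular.of_sameSide {p q : V} (h : ∀ α ∈ Φ, SameSide α p q) : Regular Φ q :=
  fun α hα => (h α hα).ne_right

theorem gap_eq_zero_iff (hn : ∀ α ∈ Φ, -α ∈ Φ) {p q : V} (hp : Regular Φ p) (hq : Regular Φ q) :
    gap Φ p q = 0 ↔ ∀ α ∈ Φ, SameSide α p q := by
  rw [gap, Finset.card_eq_zero]
  constructor
  · intro h α hα
    have h1 : α ∉ sep Φ p q := by simp [h]
    have h2 : -α ∉ sep Φ p q := by simp [h]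
    rw [mem_sep] at h1 h2
    simp only [inner_neg_left, hn α hα, hα, true_and, not_and, not_lt] at h1 h2
    rcases lt_or_gt_of_ne (hp α hα) with h3 | h3
    · have h4 := h2 (by linarith)
      exact mul_pos_of_neg_of_neg h3 (lt_of_le_of_ne (by linarith) (hq α hα))
    · exact mul_pos h3 (lt_of_le_of_ne (h1 h3) (hq α hα).symm)
  · intro h
    ext α
    simp only [mem_sep, Finset.notMem_empty, iff_false, not_and, not_lt]
    exact fun hα h1 => ((h α hα).pos_iff.1 h1).le

theorem sep_congr {p p' q q' : V} (hp : ∀ α ∈ Φ, SameSide α p p')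
    (hq : ∀ α ∈ Φ, SameSide α q q') : sep Φ p q = sep Φ p' q' := by
  ext α
  simp only [mem_sep]
  exact and_congr_right fun hα => by rw [(hp α hα).pos_iff, (hq α hα).neg_iff]

theorem gap_congr {p p' q q' : V} (hp : ∀ α ∈ Φ, SameSide α p p')
    (hq : ∀ α ∈ Φ, SameSide α q q') : gap Φ p q = gap Φ p' q' := by
  rw [gap, gap, sep_congr hp hq]

theorem neg_mem_sep (hn : ∀ α ∈ Φ, -α ∈ Φ) {p q α : V} (h : α ∈ sep Φ p q) :
    -α ∈ sep Φ q p := by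
  rw [mem_sep] at h ⊢
  simp only [inner_neg_left]
  exact ⟨hn _ h.1, by linarith [h.2.2], by linarith [h.2.1]⟩

theorem gap_comm (hn : ∀ α ∈ Φ, -α ∈ Φ) (p q : V) : gap Φ p q = gap Φ q p :=
  Finset.card_nbij' (fun α => -α) (fun α => -α) (fun _ h => neg_mem_sep hn h)
    (fun _ h => neg_mem_sep hn h) (fun _ _ => neg_neg _) (fun _ _ => neg_neg _)

theorem gap_map (g : V ≃ₗᵢ[ℝ] V) (hg : ∀ α, g α ∈ Φ ↔ α ∈ Φ) (p q : V) :
    gap Φ (g p) (g q) = gap Φ p q := by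
  refine Finset.card_nbij' (fun α => g.symm α) (fun α => g α) ?_ ?_
    (fun _ _ => g.apply_symm_apply _) (fun _ _ => g.symm_apply_apply _)
  · intro α h
    rw [Finset.mem_coe, mem_sep] at h ⊢
    rw [← hg, ← inner_map_right, ← inner_map_right]
    simpa using h
  · intro α h
    rw [Finset.mem_coe, mem_sep] at h ⊢
    rw [hg, g.inner_map_map, g.inner_map_map]
    exact h

theorem Regular.map {g : V ≃ₗᵢ[ℝ] V} (hg : ∀ α, g α ∈ Φ ↔ α ∈ Φ) {p : V} (hp : Regular Φ p) :
    Regular Φ (g p) := by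
  intro α hα
  rw [inner_map_right]
  exact hp _ (by rw [← hg]; simpa using hα)

theorem symm_mem_iff {g : V ≃ₗᵢ[ℝ] V} (hg : ∀ α, g α ∈ Φ ↔ α ∈ Φ) (α : V) :
    g.symm α ∈ Φ ↔ α ∈ Φ := by
  rw [← hg]; simp

/-- Every hyperplane between `p` and `p'` has `q` on the side of `p'`, so a path from `p` to `q`
through `p'` crosses no hyperplane twice. -/
theorem gap_eq_add {p p' q : V} (hp : Regular Φ p) (hp' : Regular Φ p')
    (h : ∀ β ∈ sep Φ p p', ⟪β, q⟫ < 0) (h' : ∀ β ∈ sep Φ p' p, 0 < ⟪β, q⟫) :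
    gap Φ p q = gap Φ p p' + gap Φ p' q := by
  classical
  rw [gap, gap, gap, ← Finset.card_union_of_disjoint]
  · congr 1
    ext β
    rw [Finset.mem_union]
    constructor
    · intro hβ
      have hβ' := mem_sep.1 hβ
      rcases lt_or_gt_of_ne (hp' β hβ'.1) with h1 | h1
      · exact Or.inl (mem_sep.2 ⟨hβ'.1, hβ'.2.1, h1⟩)
      · exact Or.inr (mem_sep.2 ⟨hβ'.1, h1, hβ'.2.2⟩)
    · rintro (hβ | hβ)
      · have hβ' := mem_sep.1 hβ
        exact mem_sep.2 ⟨hβ'.1, hβ'.2.1, h β hβ⟩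
      · have hβ' := mem_sep.1 hβ
        rcases lt_or_gt_of_ne (hp β hβ'.1) with h1 | h1
        · exact absurd (h' β (mem_sep.2 ⟨hβ'.1, hβ'.2.1, h1⟩)) hβ'.2.2.not_gt
        · exact mem_sep.2 ⟨hβ'.1, h1, hβ'.2.2⟩
  · rw [Finset.disjoint_left]
    intro β h1 h2
    exact absurd (mem_sep.1 h1).2.2 (mem_sep.1 h2).2.1.not_gt

theorem gap_eq_add_of_neg (hn : ∀ α ∈ Φ, -α ∈ Φ) {p p' q : V} (hp : Regular Φ p)
    (hp' : Regular Φ p') (h : ∀ β ∈ sep Φ p p', ⟪β, q⟫ < 0) :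
    gap Φ p q = gap Φ p p' + gap Φ p' q := by
  refine gap_eq_add hp hp' h fun β hβ => ?_
  have := h _ (neg_mem_sep hn hβ)
  rw [inner_neg_left] at this
  linarith

theorem gap_triangle {p q r : V} (hq : Regular Φ q) : gap Φ p r ≤ gap Φ p q + gap Φ q r := by
  classical
  refine (Finset.card_le_card ?_).trans (Finset.card_union_le _ _)
  intro β hβ
  have hβ' := mem_sep.1 hβ
  rw [Finset.mem_union]
  rcases lt_or_gt_of_ne (hq β hβ'.1) with h1 | h1
  · exact Or.inl (mem_sep.2 ⟨hβ'.1, hβ'.2.1, h1⟩)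
  · exact Or.inr (mem_sep.2 ⟨hβ'.1, h1, hβ'.2.2⟩)

/-- Crossing the wall of `α` does not increase the displacement under `g` if `α` is negative at
`g p` or at `g⁻¹ p`. -/
theorem gap_map_le_of_sep_eq_singleton (hn : ∀ α ∈ Φ, -α ∈ Φ) {g : V ≃ₗᵢ[ℝ] V}
    (hg : ∀ α, g α ∈ Φ ↔ α ∈ Φ) {p p' α : V} (hp : Regular Φ p) (hp' : Regular Φ p')
    (hs : sep Φ p p' = {α}) (h : ⟪α, g p⟫ < 0 ∨ ⟪α, g.symm p⟫ < 0) :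
    gap Φ p' (g p') ≤ gap Φ p (g p) := by
  have h1 : gap Φ p p' = 1 := by rw [gap, hs, Finset.card_singleton]
  rcases h with h | h
  -- `p'` is one hyperplane closer to `g p` than `p` is, and replacing `g p` by `g p'` costs at most
  -- one.
  · have e := gap_eq_add_of_neg hn (q := g p) hp hp' (by simpa [hs] using h)
    have t := gap_triangle (p := p') (r := g p') (hp.map hg)
    rw [gap_map g hg] at t
    omega
  · have e := gap_eq_add_of_neg hn (q := g.symm p) hp hp' (by simpa [hs] using h)
    have t := gap_triangle (p := p') (r := g p') hp
    rw [gap_comm hn p' p] at t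
    have e1 : gap Φ p (g.symm p) = gap Φ p (g p) := by
      rw [← gap_map g hg p, g.apply_symm_apply, gap_comm hn]
    have e2 : gap Φ p' (g.symm p) = gap Φ p (g p') := by
      rw [← gap_map g hg p', g.apply_symm_apply, gap_comm hn]
    omega

end

/-! ### Moves between chambers controlled by displacement. -/

/-- A move to the same or an adjacent chamber that does not increase the displacement under `g`. -/
def WallStep (Φ : Finset V) (g : V ≃ₗᵢ[ℝ] V) (p p' : V) : Prop :=
  Regular Φ p ∧ Regular Φ p' ∧ gap Φ p p' ≤ 1 ∧ gap Φ p' (g p') ≤ gap Φ p (g p)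

/-- A move that preserves the displacement under `g` and either goes to the same or an adjacent
chamber or lies on a geodesic through `g p` or `g⁻¹ p`. -/
def Link (Φ : Finset V) (g : V ≃ₗᵢ[ℝ] V) (p p' : V) : Prop :=
  Regular Φ p ∧ Regular Φ p' ∧ gap Φ p (g p) = gap Φ p' (g p') ∧
    (gap Φ p p' ≤ 1 ∨ gap Φ p' (g p) = gap Φ p' p + gap Φ p (g p) ∨
      gap Φ p' (g.symm p) = gap Φ p' p + gap Φ p (g.symm p))

theorem WallStep.of_sameSide {Φ : Finset V} {g : V ≃ₗᵢ[ℝ] V} (hn : ∀ α ∈ Φ, -α ∈ Φ)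
    (hg : ∀ α, g α ∈ Φ ↔ α ∈ Φ) {p p' : V}
    (h : ∀ α ∈ Φ, SameSide α p p') : WallStep Φ g p p' := by
  have hp : Regular Φ p := fun α hα => (h α hα).ne_left
  have hp' : Regular Φ p' := .of_sameSide h
  refine ⟨hp, hp', by rw [(gap_eq_zero_iff hn hp hp').2 h]; exact zero_le_one, le_of_eq ?_⟩
  exact gap_congr (fun α hα => (h α hα).symm)
    fun α hα => (sameSide_map g).2 (h _ ((symm_mem_iff hg α).2 hα)).symm

theorem Link.symm {Φ : Finset V} {g : V ≃ₗᵢ[ℝ] V} (hn : ∀ α ∈ Φ, -α ∈ Φ)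
    (hg : ∀ α, g α ∈ Φ ↔ α ∈ Φ) {p p' : V} (h : Link Φ g p p') : Link Φ g p' p := by
  have a (x y : V) : gap Φ x (g.symm y) = gap Φ y (g x) := by
    rw [← gap_map g hg x, g.apply_symm_apply, gap_comm hn]
  obtain ⟨h1, h2, h3, h4⟩ := h
  refine ⟨h2, h1, h3.symm, ?_⟩
  rw [a, a, gap_comm hn p p']
  rw [a, a, gap_comm hn p p'] at h4
  rcases h4 with h4 | h4 | h4
  · exact Or.inl h4
  · right; right; omega
  · right; left; omega

theorem link_symmetric {Φ : Finset V} {g : V ≃ₗᵢ[ℝ] V} (hn : ∀ α ∈ Φ, -α ∈ Φ)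
    (hg : ∀ α, g α ∈ Φ ↔ α ∈ Φ) {p p' : V} (h : Relation.ReflTransGen (Link Φ g) p p') :
    Relation.ReflTransGen (Link Φ g) p' p := by
  induction h with
  | refl => exact .refl
  | tail _ h ih => exact .head (h.symm hn hg) ih

theorem reflTransGen_wallStep_le {Φ : Finset V} {g : V ≃ₗᵢ[ℝ] V} {p p' : V}
    (h : Relation.ReflTransGen (WallStep Φ g) p p') : gap Φ p' (g p') ≤ gap Φ p (g p) := by
  induction h with
  | refl => exact le_rfl
  | tail _ h ih => exact h.2.2.2.trans ih

theorem reflTransGen_link_eq {Φ : Finset V} {g : V ≃ₗᵢ[ℝ] V} {p p' : V}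
    (h : Relation.ReflTransGen (Link Φ g) p p') : gap Φ p' (g p') = gap Φ p (g p) := by
  induction h with
  | refl => exact rfl
  | tail _ h ih => exact h.2.2.1.symm.trans ih

theorem reflTransGen_wallStep_regular {Φ : Finset V} {g : V ≃ₗᵢ[ℝ] V} {p p' : V}
    (hp : Regular Φ p) (h : Relation.ReflTransGen (WallStep Φ g) p p') : Regular Φ p' := by
  cases h with
  | refl => exact hp
  | tail _ h => exact h.2.1

/-- A chain of wall steps from a point of minimal displacement is a chain of links. -/
theorem reflTransGen_link_of_wallStep {Φ : Finset V} {g : V ≃ₗᵢ[ℝ] V} {p p' : V}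
    (hm : ∀ q, Regular Φ q → gap Φ p (g p) ≤ gap Φ q (g q))
    (h : Relation.ReflTransGen (WallStep Φ g) p p') : Relation.ReflTransGen (Link Φ g) p p' := by
  induction h with
  | refl => exact .refl
  | tail h h' ih =>
    refine ih.tail ⟨h'.1, h'.2.1, le_antisymm ?_ h'.2.2.2, Or.inl h'.2.2.1⟩
    exact (reflTransGen_wallStep_le h).trans (hm _ h'.2.1)

/-- The hypotheses put `p` on a geodesic from `p'` to `g p`, and `p'` on one from `p` to `g⁻¹ p'`.
Both express the gap between `p'` and `g p`; cancelling the gap between `p` and `p'` shows that the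
displacements agree. -/
theorem link_of_sep (Φ : Finset V) {g : V ≃ₗᵢ[ℝ] V} (hn : ∀ α ∈ Φ, -α ∈ Φ)
    (hg : ∀ α, g α ∈ Φ ↔ α ∈ Φ) {p p' : V} (hp : Regular Φ p) (hp' : Regular Φ p')
    (h : ∀ α ∈ sep Φ p p', 0 < ⟪α, g p⟫) (h' : ∀ α ∈ sep Φ p p', ⟪α, g.symm p'⟫ < 0) :
    Link Φ g p p' := by
  have a (x y : V) : gap Φ x (g.symm y) = gap Φ y (g x) := by
    rw [← gap_map g hg x, g.apply_symm_apply, gap_comm hn]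
  have e1 : gap Φ p' (g p) = gap Φ p' p + gap Φ p (g p) := by
    refine gap_eq_add_of_neg hn hp' hp fun β hβ => ?_
    have := h _ (neg_mem_sep hn hβ)
    rw [inner_neg_left] at this
    linarith
  have e2 := gap_eq_add_of_neg hn hp hp' h'
  rw [a, a, gap_comm hn p p'] at e2
  exact ⟨hp, hp', by omega, Or.inr (Or.inl e1)⟩

/-! ### Generic perturbations and first crossings. -/

section Perturb

open Filter

theorem eventually_sameSide (Ψ : Finset V) (p k : V) :
    ∀ᶠ ε : ℝ in 𝓝[>] 0, ∀ α ∈ Ψ, ⟪α, p⟫ ≠ 0 → SameSide α p (p + ε • k) := by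
  rw [Filter.eventually_all_finset]
  intro α _
  by_cases h : ⟪α, p⟫ = 0
  · simp [h]
  have hc : Continuous fun ε : ℝ => ⟪α, p⟫ * ⟪α, p + ε • k⟫ := by fun_prop
  have h0 : 0 < ⟪α, p⟫ * ⟪α, p + (0 : ℝ) • k⟫ := by simpa using mul_self_pos.2 h
  have := (hc.tendsto 0).eventually (lt_mem_nhds h0)
  filter_upwards [nhdsWithin_le_nhds this] with ε hε _ using hε

theorem exists_sameSide (Ψ : Finset V) (p k : V) :
    ∃ ε : ℝ, 0 < ε ∧ ∀ α ∈ Ψ, ⟪α, p⟫ ≠ 0 → SameSide α p (p + ε • k) :=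
  ((eventually_mem_nhdsWithin.and (eventually_sameSide Ψ p k)).exists).imp fun _ h => h

/-- A point can be moved slightly inside `K`, off finitely many hyperplanes that do not
contain `K`. -/
theorem exists_perturb (K : Submodule ℝ V) (Ψ F : Finset V) (p : V)
    (hF : ∀ f ∈ F, ∃ k ∈ K, ⟪f, k⟫ ≠ 0) :
    ∃ r ∈ K, (∀ f ∈ F, ⟪f, p + r⟫ ≠ 0) ∧ ∀ α ∈ Ψ, ⟪α, p⟫ ≠ 0 → SameSide α p (p + r) := by
  classical
  induction F using Finset.induction_on with
  | empty => exact ⟨0, K.zero_mem, by simp, fun α _ h => by simpa using sameSide_self h⟩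
  | insert f F _ ih =>
    obtain ⟨r, hr, h1, h2⟩ := ih fun f hf => hF f (Finset.mem_insert_of_mem hf)
    by_cases hfr : ⟪f, p + r⟫ = 0
    · obtain ⟨k, hk, hfk⟩ := hF f (Finset.mem_insert_self _ _)
      -- Since `f` vanishes at `p + r`, any positive multiple of `k` moves off it; `ε` need only be
      -- small enough to keep the signs already secured for `Ψ` and `F`.
      obtain ⟨ε, hε, h3⟩ := exists_sameSide (Ψ ∪ F) (p + r) k
      refine ⟨r + ε • k, K.add_mem hr (K.smul_mem _ hk), ?_, ?_⟩
      · intro f' hf'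
        rw [← add_assoc]
        rcases Finset.mem_insert.1 hf' with rfl | hf'
        · rw [inner_add_right, hfr, inner_smul_right, zero_add]
          exact mul_ne_zero hε.ne' hfk
        · exact (h3 f' (Finset.mem_union_right _ hf') (h1 f' hf')).ne_right
      · intro α hα h
        rw [← add_assoc]
        exact (h2 α hα h).trans (h3 α (Finset.mem_union_left _ hα) (h2 α hα h).ne_right)
    · refine ⟨r, hr, fun f' hf' => ?_, h2⟩
      rcases Finset.mem_insert.1 hf' with rfl | hf'
      exacts [hfr, h1 f' hf']

/-- On the way from a point `p` of `K` in the direction `x`, the first hyperplane met. -/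
theorem exists_first_crossing (K : Submodule ℝ V) (Ψ : Finset V) (hn : ∀ α ∈ Ψ, -α ∈ Ψ)
    {p x : V} (hp : Regular Ψ p) (hpK : p ∈ K) (hxK : x ∈ K)
    (hb : ∃ β ∈ Ψ, 0 < ⟪β, p⟫ ∧ ⟪β, x⟫ < 0) :
    ∃ h ∈ K, ∃ q ∈ K, ∃ β ∈ Ψ, 0 < ⟪β, p⟫ ∧ ⟪β, x⟫ < 0 ∧ ⟪β, h⟫ = 0 ∧ ⟪β, q⟫ < 0 ∧
      gap Ψ q x < gap Ψ p x ∧ ∀ α ∈ Ψ, (∃ c : ℝ, ∀ k ∈ K, ⟪α, k⟫ = c * ⟪β, k⟫) ∨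
        (SameSide α p h ∧ SameSide α p q) := by
  classical
  -- If neither `⟪α, x⟫` nor `⟪β, x⟫` vanishes, `⟪β, x⟫ • α - ⟪α, x⟫ • β` is orthogonal to `p'`
  -- exactly when the line `p' + t • x` meets both hyperplanes at the same time. A combination
  -- vanishing on `K` makes `α` and `β` proportional there; such ties are unavoidable and are left
  -- out.
  let F : Finset V := ((Ψ ×ˢ Ψ).image fun ab => ⟪ab.2, x⟫ • ab.1 - ⟪ab.1, x⟫ • ab.2).filter
    fun f => ∃ k ∈ K, ⟪f, k⟫ ≠ 0
  obtain ⟨r, hr, hF, hs⟩ := exists_perturb K Ψ F p fun f hf => (Finset.mem_filter.1 hf).2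
  set p' := p + r with hp'
  have hp'K : p' ∈ K := K.add_mem hpK hr
  have hs' : ∀ α ∈ Ψ, SameSide α p p' := fun α hα => hs α hα (hp α hα)
  let Bd := sep Ψ p' x
  have hBd : Bd.Nonempty := by
    obtain ⟨β, hβ, h1, h2⟩ := hb
    exact ⟨β, mem_sep.2 ⟨hβ, (hs' β hβ).pos_iff.1 h1, h2⟩⟩
  obtain ⟨β, hβ, hmin⟩ := Finset.exists_min_image Bd (fun β => ⟪β, p'⟫ / (-⟪β, x⟫)) hBd
  obtain ⟨hβΨ, hβp, hβx⟩ := mem_sep.1 hβ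
  set s := ⟪β, p'⟫ / (-⟪β, x⟫) with hsdef
  have hs0 : 0 < s := div_pos hβp (by linarith)
  have hβh : ⟪β, p' + s • x⟫ = 0 := by
    have := hβx.ne
    rw [inner_add_right, inner_smul_right, hsdef]
    field_simp
    ring
  have key : ∀ α ∈ Ψ, (¬ ∃ c : ℝ, ∀ k ∈ K, ⟪α, k⟫ = c * ⟪β, k⟫) → 0 < ⟪α, p'⟫ →
      0 < ⟪α, p' + s • x⟫ := by
    intro α hα hc hαp
    rw [inner_add_right, inner_smul_right]
    rcases le_or_gt 0 ⟪α, x⟫ with hx | hx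
    · positivity
    have hle := hmin α (mem_sep.2 ⟨hα, hαp, hx⟩)
    have hne : ⟪β, x⟫ * ⟪α, p'⟫ - ⟪α, x⟫ * ⟪β, p'⟫ ≠ 0 := by
      have hmem : ⟪β, x⟫ • α - ⟪α, x⟫ • β ∈ F := by
        refine Finset.mem_filter.2 ⟨Finset.mem_image.2 ⟨(α, β), by simp [hα, hβΨ], rfl⟩, ?_⟩
        by_contra hcon
        push Not at hcon
        refine hc ⟨⟪α, x⟫ / ⟪β, x⟫, fun k hk => ?_⟩
        have := hcon k hk
        rw [inner_sub_left, inner_smul_left, inner_smul_left] at this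
        simp only [conj_trivial] at this
        rw [div_mul_eq_mul_div, eq_div_iff hβx.ne]
        linarith
      have := hF _ hmem
      rw [inner_sub_left, inner_smul_left, inner_smul_left] at this
      simpa using this
    have hlt : s < ⟪α, p'⟫ / (-⟪α, x⟫) := by
      refine lt_of_le_of_ne hle fun he => hne ?_
      rw [hsdef, div_eq_div_iff (by linarith) (by linarith)] at he
      linarith
    rw [lt_div_iff₀ (by linarith)] at hlt
    linarith
  have key' : ∀ α ∈ Ψ, (¬ ∃ c : ℝ, ∀ k ∈ K, ⟪α, k⟫ = c * ⟪β, k⟫) →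
      SameSide α p' (p' + s • x) := by
    intro α hα hc
    rcases lt_or_gt_of_ne (hs' α hα).ne_right with h1 | h1
    · have h2 := key (-α) (hn α hα) ?_ (by rw [inner_neg_left]; linarith)
      · rw [inner_neg_left] at h2
        exact mul_pos_of_neg_of_neg h1 (by linarith)
      · rintro ⟨c, h⟩
        refine hc ⟨-c, fun k hk => ?_⟩
        have := h k hk
        rw [inner_neg_left] at this
        linarith
    · exact mul_pos h1 (key α hα hc h1)
  -- The point `q` passes the first crossing by so little that no hyperplane away from that crossing
  -- is reached.
  obtain ⟨η, hη, hq⟩ := exists_sameSide Ψ (p' + s • x) x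
  have hhK : p' + s • x ∈ K := K.add_mem hp'K (K.smul_mem _ hxK)
  have hβq : ⟪β, p' + s • x + η • x⟫ < 0 := by
    rw [inner_add_right, hβh, zero_add, inner_smul_right]
    exact mul_neg_of_pos_of_neg hη hβx
  have hβp := (hs' β hβΨ).pos_iff.2 hβp
  have hall : ∀ α ∈ Ψ, (∃ c : ℝ, ∀ k ∈ K, ⟪α, k⟫ = c * ⟪β, k⟫) ∨
      (SameSide α p (p' + s • x) ∧ SameSide α p (p' + s • x + η • x)) := by
    intro α hα
    by_cases hc : ∃ c : ℝ, ∀ k ∈ K, ⟪α, k⟫ = c * ⟪β, k⟫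
    · exact Or.inl hc
    · have h1 := (hs' α hα).trans (key' α hα hc)
      exact Or.inr ⟨h1, h1.trans (hq α hα h1.ne_right)⟩
  have hqK : p' + s • x + η • x ∈ K := K.add_mem hhK (K.smul_mem _ hxK)
  refine ⟨p' + s • x, hhK, _, hqK, β, hβΨ, hβp, hβx, hβh, hβq, ?_, hall⟩
  -- Nothing new separates `q` from `x`, and `β` no longer does.
  refine Finset.card_lt_card ((Finset.ssubset_iff_of_subset fun α hα => ?_).2
    ⟨β, mem_sep.2 ⟨hβΨ, hβp, hβx⟩, fun hα => ?_⟩)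
  · obtain ⟨hα, h1, h2⟩ := mem_sep.1 hα
    rcases hall α hα with ⟨c, hc⟩ | h
    · rw [hc _ hqK] at h1
      rw [hc _ hxK] at h2
      have hc0 : c < 0 := by
        by_contra h
        exact (mul_nonpos_of_nonneg_of_nonpos (not_lt.1 h) hβq.le).not_gt h1
      exact absurd (mul_pos_of_neg_of_neg hc0 hβx) h2.not_gt
    · exact mem_sep.2 ⟨hα, h.2.pos_iff.2 h1, h2⟩
  · exact absurd (mem_sep.1 hα).2.1 hβq.not_gt

end Perturb

/-! ### Galleries around a point of a closed chamber. -/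

/-- `v` lies in the closure of the chamber of `p`. -/
def InClosure (Φ : Finset V) (v p : V) : Prop := ∀ α ∈ Φ, 0 < ⟪α, p⟫ → 0 ≤ ⟪α, v⟫

theorem InClosure.sameSide {Φ : Finset V} (hn : ∀ α ∈ Φ, -α ∈ Φ) {v p : V} (hp : Regular Φ p)
    (h : InClosure Φ v p) {α : V} (hα : α ∈ Φ) (hv : ⟪α, v⟫ ≠ 0) : SameSide α v p := by
  rcases lt_or_gt_of_ne (hp α hα) with h1 | h1
  · have := h (-α) (hn α hα) (by rw [inner_neg_left]; linarith)
    rw [inner_neg_left] at this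
    exact mul_pos_of_neg_of_neg (lt_of_le_of_ne (by linarith) hv) h1
  · exact mul_pos (lt_of_le_of_ne (h α hα h1) hv.symm) h1

/-- Around a point `v` of the closure of a chamber there is a gallery, crossing only walls that
contain `v` and from whose positive side `x` is not visible, to a chamber with no such wall. -/
theorem exists_gallery {Φ : Finset V} (hn : ∀ α ∈ Φ, -α ∈ Φ)
    (hr : ∀ α ∈ Φ, ∀ β ∈ Φ, ∀ c : ℝ, α = c • β → α = β ∨ α = -β) {v p : V} (x : V)
    (hp : Regular Φ p) (hv : InClosure Φ v p) :
    ∃ p', Relation.ReflTransGen (fun a b => Regular Φ a ∧ Regular Φ b ∧ InClosure Φ v a ∧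
        ∃ α ∈ Φ, sep Φ a b = {α} ∧ ⟪α, v⟫ = 0 ∧ ⟪α, x⟫ < 0) p p' ∧
      Regular Φ p' ∧ InClosure Φ v p' ∧
        ∀ α ∈ Φ, ⟪α, v⟫ = 0 → 0 < ⟪α, p'⟫ → 0 ≤ ⟪α, x⟫ := by
  classical
  set Ψ := Φ.filter fun α => ⟪α, v⟫ = 0 with hΨ
  have hnΨ : ∀ α ∈ Ψ, -α ∈ Ψ := by
    intro α hα
    rw [hΨ, Finset.mem_filter] at hα ⊢
    rw [inner_neg_left, hα.2, neg_zero]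
    exact ⟨hn α hα.1, rfl⟩
  induction hk : gap Ψ p x using Nat.strong_induction_on generalizing p with
  | _ k ih =>
  by_cases hb : ∃ β ∈ Ψ, 0 < ⟪β, p⟫ ∧ ⟪β, x⟫ < 0
  swap
  · push Not at hb
    exact ⟨p, .refl, hp, hv, fun α hα h1 h2 => hb α (by simp [hΨ, hα, h1]) h2⟩
  have hpΨ : Regular Ψ p := fun α hα => hp α (Finset.mem_filter.1 hα).1
  -- With `K = ⊤`, roots proportional to `β` are `±β`, so just one wall is crossed. The chamber of
  -- `v + ε • q` copies `q` on the hyperplanes through `v` and keeps the signs of `v`, hence of `p`,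
  -- on all others.
  obtain ⟨h, -, q, -, β, hβΨ, hβp, hβx, hβh, hβq, hlt, hall⟩ :=
    exists_first_crossing ⊤ Ψ hnΨ hpΨ trivial trivial hb
  obtain ⟨hβ, hβv⟩ := Finset.mem_filter.1 hβΨ
  obtain ⟨ε, hε, hs⟩ := exists_sameSide Φ v q
  have hin : ∀ α ∈ Φ, ⟪α, v⟫ = 0 → ⟪α, v + ε • q⟫ = ε * ⟪α, q⟫ := by
    intro α _ h
    rw [inner_add_right, h, zero_add, inner_smul_right]
  have hcase : ∀ α ∈ Φ, α = β ∨ α = -β ∨ SameSide α p (v + ε • q) := by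
    intro α hα
    by_cases hαv : ⟪α, v⟫ = 0
    · rcases hall α (by simp [hΨ, hα, hαv]) with ⟨c, hc⟩ | ⟨-, h2⟩
      · have : α = c • β := by
          refine ext_inner_right ℝ fun k => ?_
          rw [hc k trivial, inner_smul_left]; simp
        rcases hr α hα β hβ c this with h | h
        exacts [Or.inl h, Or.inr (Or.inl h)]
      · refine Or.inr (Or.inr ?_)
        unfold SameSide at h2 ⊢
        rw [hin α hα hαv, mul_left_comm]
        exact mul_pos hε h2
    · exact Or.inr (Or.inr ((hv.sameSide hn hp hα hαv).symm.trans (hs α hα hαv)))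
  have hβ1 : ⟪β, v + ε • q⟫ < 0 := by
    rw [hin β hβ hβv]
    exact mul_neg_of_pos_of_neg hε hβq
  have hp1 : Regular Φ (v + ε • q) := by
    intro α hα
    rcases hcase α hα with rfl | rfl | h
    · exact hβ1.ne
    · rw [inner_neg_left]; exact (neg_pos.2 hβ1).ne'
    · exact h.ne_right
  have hv1 : InClosure Φ v (v + ε • q) := by
    intro α hα h1
    by_cases hαv : ⟪α, v⟫ = 0
    · exact hαv.ge
    · exact ((hs α hα hαv).pos_iff.2 h1).le
  have hsep : sep Φ p (v + ε • q) = {β} := by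
    ext α
    rw [mem_sep, Finset.mem_singleton]
    constructor
    · rintro ⟨hα, h1, h2⟩
      rcases hcase α hα with h | rfl | h
      · exact h
      · rw [inner_neg_left] at h1; linarith
      · exact absurd (h.pos_iff.1 h1) h2.not_gt
    · rintro rfl
      exact ⟨hβ, hβp, hβ1⟩
  have hgap : gap Ψ (v + ε • q) x = gap Ψ q x := by
    unfold gap
    congr 1
    ext α
    rw [mem_sep, mem_sep]
    refine and_congr_right fun hα => ?_
    obtain ⟨h1, h2⟩ := Finset.mem_filter.1 hα
    rw [hin α h1 h2, mul_pos_iff_of_pos_left hε]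
  obtain ⟨p', h1, h2⟩ := ih _ (by omega) hp1 hv1 hgap
  exact ⟨p', .head ⟨hp, hp1, hv, β, hβ, hsep, hβv, hβx⟩ h1, h2⟩

/-! ### Reaching the top eigenspace of the symmetrized isometry. -/

/-- The symmetric operator `g + g⁻¹` of an isometry `g`. -/
noncomputable def symmetrized (g : V ≃ₗᵢ[ℝ] V) : V →ₗ[ℝ] V :=
  g.toLinearEquiv.toLinearMap + g.symm.toLinearEquiv.toLinearMap

theorem symmetrized_apply (g : V ≃ₗᵢ[ℝ] V) (v : V) : symmetrized g v = g v + g.symm v := rfl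

theorem symmetrized_isSymmetric (g : V ≃ₗᵢ[ℝ] V) (x y : V) :
    ⟪symmetrized g x, y⟫ = ⟪x, symmetrized g y⟫ := by
  rw [symmetrized_apply, symmetrized_apply, inner_add_left, inner_add_right, inner_map_right,
    inner_symm_right, add_comm]

/-- The part of the `μ`-eigenspace of `g + g⁻¹` inside `E`. -/
noncomputable def eigenpart (g : V ≃ₗᵢ[ℝ] V) (E : Submodule ℝ V) (μ : ℝ) : Submodule ℝ V :=
  E ⊓ LinearMap.ker (symmetrized g - μ • LinearMap.id)

theorem mem_eigenpart {g : V ≃ₗᵢ[ℝ] V} {E : Submodule ℝ V} {μ : ℝ} {v : V} :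
    v ∈ eigenpart g E μ ↔ v ∈ E ∧ symmetrized g v = μ • v := by
  simp [eigenpart, sub_eq_zero]

/-- `μ` is an upper bound for the quadratic form of `T` on `E`, attained only at eigenvectors. -/
structure IsTop (T : V →ₗ[ℝ] V) (E : Submodule ℝ V) (μ : ℝ) : Prop where
  le : ∀ v ∈ E, ⟪T v, v⟫ ≤ μ * ⟪v, v⟫
  eigen : ∀ v ∈ E, ⟪T v, v⟫ = μ * ⟪v, v⟫ → T v = μ • v

/-- The Rayleigh quotient attains its maximum on the compact unit sphere of `E`, and a vector
attaining the bound is critical, hence an eigenvector. -/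
theorem exists_isTop [FiniteDimensional ℝ V] (T : V →ₗ[ℝ] V)
    (hT : ∀ x y, ⟪T x, y⟫ = ⟪x, T y⟫) (E : Submodule ℝ V) (hE : ∀ v ∈ E, T v ∈ E) (h0 : E ≠ ⊥) :
    ∃ μ, IsTop T E μ ∧ ∃ v ∈ E, v ≠ 0 ∧ T v = μ • v := by
  have hTc : Continuous T := T.continuous_of_finiteDimensional
  have hcpt : IsCompact (Metric.sphere (0 : V) 1 ∩ E) :=
    (isCompact_sphere 0 1).inter_right E.closed_of_finiteDimensional
  have hnorm : ∀ x ∈ E, x ≠ 0 → ‖x‖⁻¹ • x ∈ Metric.sphere (0 : V) 1 ∩ E := by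
    intro x hx hx0
    refine ⟨?_, E.smul_mem _ hx⟩
    rw [mem_sphere_zero_iff_norm, norm_smul, norm_inv, norm_norm,
      inv_mul_cancel₀ (norm_ne_zero_iff.2 hx0)]
  obtain ⟨x, hx, hx0⟩ := Submodule.exists_mem_ne_zero_of_ne_bot h0
  obtain ⟨v, ⟨hv1, hvE⟩, hmax⟩ := hcpt.exists_isMaxOn ⟨_, hnorm x hx hx0⟩
    (f := fun v => ⟪T v, v⟫) (by fun_prop)
  rw [mem_sphere_zero_iff_norm] at hv1
  set μ := ⟪T v, v⟫ with hμ
  have hle : ∀ v ∈ E, ⟪T v, v⟫ ≤ μ * ⟪v, v⟫ := by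
    intro y hy
    by_cases hy0 : y = 0
    · simp [hy0]
    have h1 : ⟪T (‖y‖⁻¹ • y), ‖y‖⁻¹ • y⟫ ≤ μ := hmax (hnorm y hy hy0)
    rw [map_smul, inner_smul_left, inner_smul_right] at h1
    simp only [conj_trivial] at h1
    have h2 : 0 < ‖y‖ := norm_pos_iff.2 hy0
    rw [real_inner_self_eq_norm_sq]
    have h3 : ⟪T y, y⟫ = ‖y‖ ^ 2 * (‖y‖⁻¹ * (‖y‖⁻¹ * ⟪T y, y⟫)) := by field_simp
    rw [h3, mul_comm μ]
    exact mul_le_mul_of_nonneg_left h1 (by positivity)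
  have heig : ∀ v ∈ E, ⟪T v, v⟫ = μ * ⟪v, v⟫ → T v = μ • v := by
    intro v hv he
    set y := μ • v - T v with hy
    have hyE : y ∈ E := E.sub_mem (E.smul_mem _ hv) (hE v hv)
    have hy' : μ * ⟪v, y⟫ - ⟪T v, y⟫ = ⟪y, y⟫ := by
      conv_rhs => rw [hy, inner_sub_left, inner_smul_left]
      simp [hy]
    -- The nonnegative form `μ⟪·, ·⟫ - ⟪T ·, ·⟫` evaluated at `v - t • y`; it vanishes at `v`, so a
    -- nonzero linear coefficient would make it negative for small `t > 0`.
    have hq : ∀ t : ℝ, 0 ≤ -2 * t * ⟪y, y⟫ + t ^ 2 * (μ * ⟪y, y⟫ - ⟪T y, y⟫) := by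
      intro t
      have h1 := hle (v - t • y) (E.sub_mem hv (E.smul_mem _ hyE))
      have h2 : ⟪T y, v⟫ = ⟪T v, y⟫ := by rw [hT, real_inner_comm]
      simp only [map_sub, map_smul, inner_sub_left, inner_sub_right, inner_smul_left,
        inner_smul_right, conj_trivial, h2, real_inner_comm v y] at h1
      rw [he] at h1
      linear_combination h1 - 2 * t * hy'
    have hy0 : ⟪y, y⟫ = 0 := by
      have h0 : 0 ≤ ⟪y, y⟫ := real_inner_self_nonneg
      set Q := μ * ⟪y, y⟫ - ⟪T y, y⟫
      have hQ : 0 ≤ Q := by linarith [hle y hyE]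
      -- Using `Q + 1` rather than `Q` keeps the denominator positive when `Q = 0`.
      have h1 := hq (⟪y, y⟫ / (Q + 1))
      have h2 : -2 * (⟪y, y⟫ / (Q + 1)) * ⟪y, y⟫ + (⟪y, y⟫ / (Q + 1)) ^ 2 * Q =
          -(⟪y, y⟫ ^ 2 * ((Q + 2) / (Q + 1) ^ 2)) := by
        field_simp; ring
      rw [h2] at h1
      have h3 : 0 < (Q + 2) / (Q + 1) ^ 2 := by positivity
      by_contra h
      have : 0 < ⟪y, y⟫ ^ 2 * ((Q + 2) / (Q + 1) ^ 2) := by positivity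
      linarith
    have := inner_self_eq_zero.1 hy0
    exact (sub_eq_zero.1 (hy ▸ this)).symm
  refine ⟨μ, ⟨hle, heig⟩, v, hvE, ?_, heig v hvE ?_⟩
  · rintro rfl; simp at hv1
  · rw [real_inner_self_eq_norm_sq, hv1]; simp [hμ]

/-- `v` is a point of `K` in the closure of the chamber of `p`, and it lies only on those
hyperplanes that contain `K`. -/
def GoodAt (Φ : Finset V) (K : Submodule ℝ V) (v p : V) : Prop :=
  v ∈ K ∧ ∀ α ∈ Φ, (∃ k ∈ K, ⟪α, k⟫ ≠ 0) → SameSide α v p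

/-- If `α` were positive at both `g a` and `g⁻¹ a`, passing to the closure would make `⟪α, g v⟫` and
`⟪α, g⁻¹ v⟫` nonnegative, against the sign of their sum. -/
theorem gallery_wallStep {Φ : Finset V} (hn : ∀ α ∈ Φ, -α ∈ Φ) {g : V ≃ₗᵢ[ℝ] V}
    (hg : ∀ α, g α ∈ Φ ↔ α ∈ Φ) {v a b : V}
    (h : Regular Φ a ∧ Regular Φ b ∧ InClosure Φ v a ∧
        ∃ α ∈ Φ, sep Φ a b = {α} ∧ ⟪α, v⟫ = 0 ∧ ⟪α, symmetrized g v⟫ < 0) :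
    WallStep Φ g a b := by
  obtain ⟨ha, hb, hv, α, hα, hs, -, hx⟩ := h
  refine ⟨ha, hb, by rw [gap, hs, Finset.card_singleton],
    gap_map_le_of_sep_eq_singleton hn hg ha hb hs ?_⟩
  by_contra hcon
  push Not at hcon
  rw [inner_map_right, inner_symm_right] at hcon
  have h1 := (symm_mem_iff hg α).2 hα
  have h2 := (hg α).2 hα
  have h3 := hv _ h1 (lt_of_le_of_ne hcon.1 (ha _ h1).symm)
  have h4 := hv _ h2 (lt_of_le_of_ne hcon.2 (ha _ h2).symm)
  rw [symmetrized_apply, inner_add_right, inner_map_right, inner_symm_right] at hx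
  linarith

/-- A closed chamber depends only on the set of roots positive on it, so the union is one of
finitely many closed sets. -/
theorem isClosed_reachable (Φ : Finset V) (R : V → Prop) :
    IsClosed {v | ∃ p, R p ∧ InClosure Φ v p} := by
  classical
  let S : Set (Finset V) := {s | s ∈ Φ.powerset ∧ ∃ p, R p ∧ s = Φ.filter fun α => 0 < ⟪α, p⟫}
  have hS : S.Finite := Φ.powerset.finite_toSet.subset fun s hs => hs.1
  have : {v | ∃ p, R p ∧ InClosure Φ v p} = ⋃ s ∈ S, {v | ∀ α ∈ s, 0 ≤ ⟪α, v⟫} := by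
    ext v
    simp only [Set.mem_ofPred_eq, Set.mem_iUnion]
    constructor
    · rintro ⟨p, h1, h2⟩
      exact ⟨_, ⟨Finset.mem_powerset.2 (Finset.filter_subset _ _), p, h1, rfl⟩,
        fun α hα => h2 α (Finset.mem_filter.1 hα).1 (Finset.mem_filter.1 hα).2⟩
    · rintro ⟨s, ⟨-, p, h1, rfl⟩, h2⟩
      exact ⟨p, h1, fun α hα h => h2 α (Finset.mem_filter.2 ⟨hα, h⟩)⟩
  rw [this]
  refine hS.isClosed_biUnion fun s _ => ?_
  simp only [Set.ofPred_forall]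
  exact isClosed_biInter fun α _ => isClosed_le continuous_const (by fun_prop)

/-- Symmetry of the operator moves it onto vectors of `K`, where it is the scalar `μ`. This keeps
the `K`-component of `v + ε • T v` on the line of the `K`-component of `v`. -/
theorem inner_starProjection_symmetrized {g : V ≃ₗᵢ[ℝ] V} {E : Submodule ℝ V} {μ : ℝ}
    [FiniteDimensional ℝ V] (x : V) :
    (eigenpart g E μ).starProjection (symmetrized g x) =
      μ • (eigenpart g E μ).starProjection x := by
  set K := eigenpart g E μ
  refine Submodule.eq_starProjection_of_mem_of_inner_eq_zero
    (K.smul_mem _ (K.starProjection_apply_mem x)) fun w hw => ?_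
  rw [inner_sub_left, symmetrized_isSymmetric, (mem_eigenpart.1 hw).2, inner_smul_right,
    inner_smul_left, K.inner_starProjection_left_eq_right, K.starProjection_eq_self_iff.2 hw]
  simp

/-- Every chamber leads by wall steps to one whose closure contains a generic point of the top
eigenspace of `g + g⁻¹`. -/
theorem exists_goodAt [FiniteDimensional ℝ V] {Φ : Finset V} (hn : ∀ α ∈ Φ, -α ∈ Φ)
    (hr : ∀ α ∈ Φ, ∀ β ∈ Φ, ∀ c : ℝ, α = c • β → α = β ∨ α = -β) {g : V ≃ₗᵢ[ℝ] V}
    (hg : ∀ α, g α ∈ Φ ↔ α ∈ Φ) {E : Submodule ℝ V} (hE : ∀ v ∈ E, g v ∈ E ∧ g.symm v ∈ E)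
    (hΦ : ∀ α ∈ Φ, α ∈ E) {μ : ℝ} (hμ : IsTop (symmetrized g) E μ) {p : V} (hp : Regular Φ p) :
    ∃ p', Relation.ReflTransGen (WallStep Φ g) p p' ∧
      ∃ v, GoodAt Φ (eigenpart g E μ) v p' := by
  classical
  set K := eigenpart g E μ with hK
  set T := symmetrized g with hT
  have hTc : Continuous T := T.continuous_of_finiteDimensional
  have hTE : ∀ v ∈ E, T v ∈ E := fun v hv => E.add_mem (hE v hv).1 (hE v hv).2
  have hKE : ∀ v ∈ K, v ∈ E := fun v hv => (mem_eigenpart.1 hv).1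
  have hKP : ∀ x y : V, ⟪K.starProjection x, y⟫ = ⟪x, K.starProjection y⟫ :=
    K.inner_starProjection_left_eq_right
  -- Projecting to `E` does not change pairings with roots. A small shift along `K` then moves the
  -- `K`-component `u` off every hyperplane that does not contain `K`.
  obtain ⟨r, hrK, hrF, hrs⟩ := exists_perturb K Φ
    ((Φ.filter fun α => ∃ k ∈ K, ⟪α, k⟫ ≠ 0).image fun α => K.starProjection α)
    (E.starProjection p) (by
      intro f hf
      obtain ⟨α, hα, rfl⟩ := Finset.mem_image.1 hf
      obtain ⟨k, hk, h⟩ := (Finset.mem_filter.1 hα).2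
      refine ⟨k, hk, ?_⟩
      rwa [hKP, K.starProjection_eq_self_iff.2 hk])
  have hp0 : ∀ α ∈ Φ, ⟪α, E.starProjection p⟫ = ⟪α, p⟫ := by
    intro α hα
    rw [← E.inner_starProjection_left_eq_right, E.starProjection_eq_self_iff.2 (hΦ α hα)]
  set p₁ := E.starProjection p + r with hp₁
  have hp₁E : p₁ ∈ E := E.add_mem (E.starProjection_apply_mem p) (hKE r hrK)
  have hpp₁ : ∀ α ∈ Φ, SameSide α p p₁ := by
    intro α hα
    have := hrs α hα (by rw [hp0 α hα]; exact hp α hα)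
    unfold SameSide at this ⊢
    rwa [hp0 α hα] at this
  have hp₁r : Regular Φ p₁ := .of_sameSide hpp₁
  set u := K.starProjection p₁ with hu
  have huK : u ∈ K := K.starProjection_apply_mem p₁
  have hur : ∀ α ∈ Φ, (∃ k ∈ K, ⟪α, k⟫ ≠ 0) → ⟪α, u⟫ ≠ 0 := by
    intro α hα hk
    rw [hu, ← hKP]
    exact hrF _ (Finset.mem_image_of_mem _ (Finset.mem_filter.2 ⟨hα, hk⟩))
  have step₁ : Relation.ReflTransGen (WallStep Φ g) p p₁ :=
    .single (.of_sameSide hn hg hpp₁)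
  -- Genericity of `u = 0` means that every hyperplane contains `K`, so `0` is already a good point.
  by_cases hu0 : u = 0
  · refine ⟨p, .refl, 0, K.zero_mem, fun α hα hk => absurd ?_ (hur α hα hk)⟩
    simp [hu0]
  have huu : 0 < ⟪u, u⟫ := real_inner_self_pos.2 hu0
  have hp₁u : ⟪p₁, u⟫ = ⟪u, u⟫ := by
    rw [← K.starProjection_eq_self_iff.2 huK, ← hKP, ← hu, K.starProjection_eq_self_iff.2 huK]
  let U : Set V := {v | ∃ p', Relation.ReflTransGen (WallStep Φ g) p₁ p' ∧ InClosure Φ v p'}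
  -- Maximizing `⟪v, u⟫` over `C` takes the place of following the flow of `T` to its limit. Fixing
  -- the line of the `K`-component lets the maximizer inherit the genericity of `u`.
  let C : Set V := Metric.sphere 0 1 ∩
    (U ∩ (E ∩ {v | ⟪u, u⟫ • K.starProjection v = ⟪v, u⟫ • u}))
  have hC : IsCompact C := by
    refine (isCompact_sphere 0 1).inter_right ((isClosed_reachable Φ _).inter
      (E.closed_of_finiteDimensional.inter (isClosed_eq ?_ ?_)))
    · fun_prop
    · fun_prop
  have hCmem : ∀ y p', Relation.ReflTransGen (WallStep Φ g) p₁ p' → InClosure Φ y p' → y ∈ E →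
      ⟪u, u⟫ • K.starProjection y = ⟪y, u⟫ • u → 0 < ‖y‖ → ‖y‖⁻¹ • y ∈ C := by
    intro y p' h1 h2 h3 h4 h5
    refine ⟨?_, ⟨p', h1, fun α hα h => ?_⟩, E.smul_mem _ h3, ?_⟩
    · rw [mem_sphere_zero_iff_norm, norm_smul, norm_inv, norm_norm, inv_mul_cancel₀ h5.ne']
    · rw [inner_smul_right]
      exact mul_nonneg (inv_nonneg.2 h5.le) (h2 α hα h)
    · change ⟪u, u⟫ • K.starProjection (‖y‖⁻¹ • y) = ⟪‖y‖⁻¹ • y, u⟫ • u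
      rw [map_smul, smul_comm, h4, inner_smul_left, smul_smul]
      simp
  have hp₁0 : 0 < ‖p₁‖ := by
    rw [norm_pos_iff]
    intro h
    rw [h, inner_zero_left] at hp₁u
    exact huu.ne hp₁u
  have hp₁C := hCmem p₁ p₁ .refl (fun _ _ h => h.le) hp₁E (by rw [hp₁u]) hp₁0
  obtain ⟨v, ⟨hv1, ⟨p', hreach, hcl⟩, hvE, hvray⟩, hmax⟩ := hC.exists_isMaxOn ⟨_, hp₁C⟩
    (f := fun v => ⟪v, u⟫) (by fun_prop)
  replace hvray : ⟪u, u⟫ • K.starProjection v = ⟪v, u⟫ • u := hvray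
  rw [mem_sphere_zero_iff_norm] at hv1
  have hvu : 0 < ⟪v, u⟫ := by
    refine lt_of_lt_of_le ?_ (hmax hp₁C)
    simp only [inner_smul_left, hp₁u]
    exact mul_pos (by simpa using norm_pos_iff.1 hp₁0) huu
  have hp'r := reflTransGen_wallStep_regular hp₁r hreach
  -- The gallery ends in a chamber whose closure contains `v + ε • T v` for small `ε > 0`.
  obtain ⟨p'', hgal, hp''r, hcl'', hgood⟩ := exists_gallery hn hr (T v) hp'r hcl
  have hreach'' : Relation.ReflTransGen (WallStep Φ g) p₁ p'' :=
    hreach.trans (Relation.ReflTransGen.mono (fun a b h => gallery_wallStep hn hg h) _ _ hgal)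
  have hTvu : ⟪T v, u⟫ = μ * ⟪v, u⟫ := by
    rw [hT, symmetrized_isSymmetric, (mem_eigenpart.1 huK).2, inner_smul_right]
  -- After normalization `v + ε • T v` competes in `C`. Its pairing with `u` is `(1 + ε * μ) * ⟪v,
  -- u⟫`, so maximality gives `(1 + ε * μ) ^ 2 ≤ ‖v + ε • T v‖ ^ 2`; expand, divide by `ε` and let
  -- `ε` tend to `0`.
  have key : ∀ᶠ ε : ℝ in 𝓝[>] 0, 2 * (μ - ⟪T v, v⟫) ≤ ε * (⟪T v, T v⟫ - μ ^ 2) := by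
    have hpos : ∀ᶠ ε : ℝ in 𝓝[>] 0, 0 < 1 + ε * μ := by
      have hc : Continuous fun ε : ℝ => 1 + ε * μ := by fun_prop
      exact nhdsWithin_le_nhds ((hc.tendsto 0).eventually (lt_mem_nhds (by simp)))
    filter_upwards [eventually_sameSide Φ v (T v), hpos, self_mem_nhdsWithin] with ε hs h1 hε
    rw [Set.mem_Ioi] at hε
    set y := v + ε • T v with hy
    have hycl : InClosure Φ y p'' := by
      intro α hα h
      by_cases h0 : ⟪α, v⟫ = 0
      · rw [hy, inner_add_right, h0, zero_add, inner_smul_right]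
        exact mul_nonneg hε.le (hgood α hα h0 h)
      · exact ((hs α hα h0).pos_iff.1 (lt_of_le_of_ne (hcl'' α hα h) (Ne.symm h0))).le
    have hyu : ⟪y, u⟫ = (1 + ε * μ) * ⟪v, u⟫ := by
      rw [hy, inner_add_left, inner_smul_left, hTvu]
      simp only [conj_trivial]; ring
    have hyP : K.starProjection y = (1 + ε * μ) • K.starProjection v := by
      rw [hy, map_add, map_smul, hT, hK, inner_starProjection_symmetrized, add_smul, one_smul,
        smul_smul]
    have hyu0 : 0 < ⟪y, u⟫ := by rw [hyu]; positivity
    have hy0 : 0 < ‖y‖ := by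
      rw [norm_pos_iff]
      intro h
      rw [h, inner_zero_left] at hyu0
      exact hyu0.false
    have hyC := hCmem y p'' hreach'' hycl (E.add_mem hvE (E.smul_mem _ (hTE v hvE)))
      (by rw [hyP, hyu, smul_comm, hvray, smul_smul]) hy0
    have h2 : ⟪‖y‖⁻¹ • y, u⟫ ≤ ⟪v, u⟫ := hmax hyC
    rw [inner_smul_left, hyu] at h2
    simp only [conj_trivial] at h2
    rw [inv_mul_le_iff₀ hy0] at h2
    have h3 : 1 + ε * μ ≤ ‖y‖ := le_of_mul_le_mul_right h2 hvu
    have h4 : (1 + ε * μ) ^ 2 ≤ ‖y‖ ^ 2 := by gcongr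
    have h5 : ⟪v, v⟫ = 1 := by rw [real_inner_self_eq_norm_sq, hv1, one_pow]
    rw [← real_inner_self_eq_norm_sq, hy] at h4
    simp only [inner_add_left, inner_add_right, inner_smul_left, inner_smul_right, h5,
      conj_trivial, real_inner_comm (T v) v] at h4
    have h6 : ε * (2 * (μ - ⟪T v, v⟫)) ≤ ε * (ε * (⟪T v, T v⟫ - μ ^ 2)) := by
      have := real_inner_comm (T v) v
      nlinarith
    exact le_of_mul_le_mul_left h6 hε
  have hlim : 2 * (μ - ⟪T v, v⟫) ≤ 0 := by
    have hc : Continuous fun ε : ℝ => ε * (⟪T v, T v⟫ - μ ^ 2) := by fun_prop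
    have := (hc.tendsto 0).mono_left (nhdsWithin_le_nhds (s := Set.Ioi 0))
    rw [zero_mul] at this
    exact ge_of_tendsto this key
  have hTv : T v = μ • v := by
    refine hμ.eigen v hvE (le_antisymm (hμ.le v hvE) ?_)
    rw [real_inner_self_eq_norm_sq, hv1]
    linarith
  have hvK : v ∈ K := mem_eigenpart.2 ⟨hvE, hTv⟩
  rw [K.starProjection_eq_self_iff.2 hvK] at hvray
  refine ⟨p', step₁.trans hreach, v, hvK, fun α hα hk => hcl.sameSide hn hp'r hα fun h0 => ?_⟩
  have := congrArg (fun x => ⟪α, x⟫) hvray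
  simp only [inner_smul_right, h0, mul_zero] at this
  exact mul_ne_zero hvu.ne' (hur α hα hk) this.symm

theorem eigenpart_map {g : V ≃ₗᵢ[ℝ] V} {E : Submodule ℝ V}
    (hE : ∀ v ∈ E, g v ∈ E ∧ g.symm v ∈ E) {μ : ℝ} {v : V} (hv : v ∈ eigenpart g E μ) :
    g v ∈ eigenpart g E μ ∧ g.symm v ∈ eigenpart g E μ := by
  simp only [mem_eigenpart, symmetrized_apply] at hv ⊢
  refine ⟨⟨(hE v hv.1).1, ?_⟩, (hE v hv.1).2, ?_⟩
  · rw [← map_smul g, ← hv.2]; simp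
  · rw [← map_smul g.symm, ← hv.2]; simp

theorem Link.of_symm {Φ : Finset V} {g : V ≃ₗᵢ[ℝ] V} (hn : ∀ α ∈ Φ, -α ∈ Φ)
    (hg : ∀ α, g α ∈ Φ ↔ α ∈ Φ) {p p' : V} (h : Link Φ g.symm p p') : Link Φ g p p' := by
  have a (x : V) : gap Φ x (g.symm x) = gap Φ x (g x) := by
    rw [← gap_map g hg x, g.apply_symm_apply, gap_comm hn]
  obtain ⟨h1, h2, h3, h4⟩ := h
  rw [a, a] at h3
  rw [LinearIsometryEquiv.symm_symm] at h4
  exact ⟨h1, h2, h3, h4.imp_right Or.symm⟩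

/-! ### Crossing walls inside the top eigenspace. -/

/-- The vectors of `Φ` that are not orthogonal to `K`. -/
noncomputable def transversal (Φ : Finset V) (K : Submodule ℝ V) : Finset V :=
  open Classical in Φ.filter fun α => ∃ k ∈ K, ⟪α, k⟫ ≠ 0

theorem mem_transversal {Φ : Finset V} {K : Submodule ℝ V} {α : V} :
    α ∈ transversal Φ K ↔ α ∈ Φ ∧ ∃ k ∈ K, ⟪α, k⟫ ≠ 0 := by
  simp [transversal]

theorem neg_mem_transversal {Φ : Finset V} (hn : ∀ α ∈ Φ, -α ∈ Φ) {K : Submodule ℝ V} :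
    ∀ α ∈ transversal Φ K, -α ∈ transversal Φ K := by
  intro α hα
  obtain ⟨h1, k, hk, h2⟩ := mem_transversal.1 hα
  exact mem_transversal.2 ⟨hn α h1, k, hk, by rwa [inner_neg_left, neg_ne_zero]⟩

theorem map_mem_transversal {Φ : Finset V} {g : V ≃ₗᵢ[ℝ] V} (hg : ∀ α, g α ∈ Φ ↔ α ∈ Φ)
    {K : Submodule ℝ V} (hK : ∀ v ∈ K, g v ∈ K ∧ g.symm v ∈ K) (α : V) :
    g α ∈ transversal Φ K ↔ α ∈ transversal Φ K := by
  rw [mem_transversal, mem_transversal, hg]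
  refine and_congr_right fun _ => ⟨?_, ?_⟩
  · rintro ⟨k, hk, h⟩
    exact ⟨g.symm k, (hK k hk).2, by rwa [inner_symm_right]⟩
  · rintro ⟨k, hk, h⟩
    exact ⟨g k, (hK k hk).1, by rwa [g.inner_map_map]⟩

/-- Crossing a wall inside `K` is a link. -/
theorem link_of_crossing {Φ : Finset V} (hn : ∀ α ∈ Φ, -α ∈ Φ) {g : V ≃ₗᵢ[ℝ] V}
    (hg : ∀ α, g α ∈ Φ ↔ α ∈ Φ) {K : Submodule ℝ V} (hK : ∀ v ∈ K, g v ∈ K ∧ g.symm v ∈ K)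
    {p p₁ v v₁ β : V} (hp : Regular Φ p) (hp₁ : Regular Φ p₁) (hv : GoodAt Φ K v p)
    (hv₁ : GoodAt Φ K v₁ p₁) (hβ : 0 < ⟪β, v⟫)
    (hs : ∀ α ∈ sep Φ p p₁, α ∈ transversal Φ K ∧ ∃ c : ℝ, ∀ k ∈ K, ⟪α, k⟫ = c * ⟪β, k⟫)
    (h : 0 < ⟪β, g v⟫) (h' : ⟪β, g.symm v₁⟫ < 0) : Link Φ g p p₁ := by
  have hc : ∀ α ∈ sep Φ p p₁, α ∈ transversal Φ K ∧
      ∃ c : ℝ, 0 < c ∧ ∀ k ∈ K, ⟪α, k⟫ = c * ⟪β, k⟫ := by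
    intro α hα
    obtain ⟨h1, c, hc⟩ := hs α hα
    refine ⟨h1, c, ?_, hc⟩
    have h2 := mem_transversal.1 h1
    have h3 := (hv.2 α h2.1 h2.2).pos_iff.2 (mem_sep.1 hα).2.1
    rw [hc v hv.1] at h3
    exact (pos_iff_pos_of_mul_pos h3).2 hβ
  refine link_of_sep Φ hn hg hp hp₁ (fun α hα => ?_) fun α hα => ?_
  · obtain ⟨h1, c, hc0, hc⟩ := hc α hα
    have h2 := mem_transversal.1 ((map_mem_transversal hg hK (g.symm α)).1 (by simpa using h1))
    rw [inner_map_right, ← (hv.2 _ h2.1 h2.2).pos_iff, ← inner_map_right, hc _ (hK v hv.1).1]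
    positivity
  · obtain ⟨h1, c, hc0, hc⟩ := hc α hα
    have h2 := mem_transversal.1 ((map_mem_transversal hg hK α).2 h1)
    rw [inner_symm_right, ← (hv₁.2 _ h2.1 h2.2).neg_iff, ← inner_symm_right,
      hc _ (hK v₁ hv₁.1).2]
    exact mul_neg_of_pos_of_neg hc0 h'

/-- Any two generic points of the top eigenspace lie in the closures of linked chambers. -/
theorem exists_link_goodAt {Φ : Finset V} (hn : ∀ α ∈ Φ, -α ∈ Φ)
    {g : V ≃ₗᵢ[ℝ] V} (hg : ∀ α, g α ∈ Φ ↔ α ∈ Φ) {E : Submodule ℝ V}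
    (hE : ∀ v ∈ E, g v ∈ E ∧ g.symm v ∈ E) {μ : ℝ} (hμ : IsTop (symmetrized g) E μ)
    (hne : ¬ ∀ x ∈ E, g x = -x) {p v v' : V} (hp : Regular Φ p)
    (hv : GoodAt Φ (eigenpart g E μ) v p) (hv' : v' ∈ eigenpart g E μ)
    (hv'r : Regular (transversal Φ (eigenpart g E μ)) v') :
    ∃ p', Relation.ReflTransGen (Link Φ g) p p' ∧ Regular Φ p' ∧
      GoodAt Φ (eigenpart g E μ) v' p' := by
  set K := eigenpart g E μ with hKdef
  have hK : ∀ v ∈ K, g v ∈ K ∧ g.symm v ∈ K := fun v hv => eigenpart_map hE hv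
  set Ψ := transversal Φ K with hΨ
  have hnΨ := neg_mem_transversal hn (K := K)
  have hgΨ := map_mem_transversal hg hK
  have hsum : ∀ (β : V), ∀ k ∈ K, ⟪β, g k⟫ + ⟪β, g.symm k⟫ = μ * ⟪β, k⟫ := by
    intro β k hk
    rw [← inner_add_right, ← symmetrized_apply, (mem_eigenpart.1 hk).2, inner_smul_right]
  induction hk : gap Ψ v v' using Nat.strong_induction_on generalizing p v with
  | _ k ih =>
  have hvr : Regular Ψ v := fun α hα =>
    (hv.2 α (mem_transversal.1 hα).1 (mem_transversal.1 hα).2).ne_left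
  by_cases hb : ∃ β ∈ Ψ, 0 < ⟪β, v⟫ ∧ ⟪β, v'⟫ < 0
  swap
  · have h0 : gap Ψ v v' = 0 := by
      rw [gap, Finset.card_eq_zero, Finset.eq_empty_iff_forall_notMem]
      intro α hα
      exact hb ⟨α, mem_sep.1 hα⟩
    refine ⟨p, .refl, hp, hv', fun α hα hk => ?_⟩
    exact ((gap_eq_zero_iff hnΨ hvr hv'r).1 h0 α (mem_transversal.2 ⟨hα, hk⟩)).symm.trans
      (hv.2 α hα hk)
  obtain ⟨h, hhK, v₁, hv₁K, β, hβΨ, hβv, -, hβh, hβv₁, hlt, hall⟩ :=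
    exists_first_crossing K Ψ hnΨ hvr hv.1 hv' hb
  -- The next chamber, that of `v₁ + ε • p`, touches `v₁` and keeps the side of `p` for every
  -- hyperplane containing `K`.
  obtain ⟨ε, hε, hs⟩ := exists_sameSide Φ v₁ p
  have hv₁r : ∀ α ∈ Ψ, ⟪α, v₁⟫ ≠ 0 := by
    intro α hα
    rcases hall α hα with ⟨c, hc⟩ | ⟨-, h2⟩
    · rw [hc v₁ hv₁K]
      refine mul_ne_zero ?_ hβv₁.ne
      rintro rfl
      exact hvr α hα (by rw [hc v hv.1, zero_mul])
    · exact h2.ne_right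
  have hor : ∀ α ∈ Φ, α ∉ Ψ → SameSide α p (v₁ + ε • p) := by
    intro α hα hαΨ
    have h0 : ⟪α, v₁⟫ = 0 := by
      by_contra hcon
      exact hαΨ (mem_transversal.2 ⟨hα, v₁, hv₁K, hcon⟩)
    unfold SameSide
    rw [inner_add_right, h0, zero_add, inner_smul_right, mul_left_comm]
    exact mul_pos hε (mul_self_pos.2 (hp α hα))
  have hgood₁ : GoodAt Φ K v₁ (v₁ + ε • p) :=
    ⟨hv₁K, fun α hα hk => hs α hα (hv₁r α (mem_transversal.2 ⟨hα, hk⟩))⟩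
  have hp₁ : Regular Φ (v₁ + ε • p) := by
    intro α hα
    by_cases hαΨ : α ∈ Ψ
    · exact (hgood₁.2 α hα (mem_transversal.1 hαΨ).2).ne_right
    · exact (hor α hα hαΨ).ne_right
  have hsep : ∀ α ∈ sep Φ p (v₁ + ε • p),
      α ∈ Ψ ∧ ∃ c : ℝ, ∀ k ∈ K, ⟪α, k⟫ = c * ⟪β, k⟫ := by
    intro α hα
    obtain ⟨hα, h1, h2⟩ := mem_sep.1 hα
    have hαΨ : α ∈ Ψ := by
      by_contra hαΨ
      exact absurd ((hor α hα hαΨ).pos_iff.1 h1) h2.not_gt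
    refine ⟨hαΨ, (hall α hαΨ).resolve_right fun h3 => ?_⟩
    have hk := (mem_transversal.1 hαΨ).2
    have h4 := ((hv.2 α hα hk).symm.trans h3.2).trans (hgood₁.2 α hα hk)
    exact absurd (h4.pos_iff.1 h1) h2.not_gt
  have hlink : Link Φ g p (v₁ + ε • p) := by
    have core := link_of_crossing hn hg hK hp hp₁ hv hgood₁ hβv hsep
    have hgs : ∀ α, g.symm α ∈ Φ ↔ α ∈ Φ := symm_mem_iff hg
    have core' := link_of_crossing hn (g := g.symm) hgs
      (fun v hv => ⟨(hK v hv).2, (hK v hv).1⟩) hp hp₁ hv hgood₁ hβv hsep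
    rw [LinearIsometryEquiv.symm_symm] at core'
    have hγ : g.symm β ∈ Ψ := (hgΨ _).1 (by simpa using hβΨ)
    have hδ : g β ∈ Ψ := (hgΨ _).2 hβΨ
    -- At the wall point `h` the eigenvalue equation makes `⟪β, g h⟫` and `⟪β, g⁻¹ h⟫` opposite.
    have hh := hsum β h hhK
    rw [hβh, mul_zero] at hh
    rcases hall _ hγ with ⟨c, hc⟩ | ⟨h1, h2⟩
    · have hc1 : ∀ k ∈ K, ⟪β, g k⟫ = c * ⟪β, k⟫ := fun k hk => by rw [inner_map_right, hc k hk]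
      have hc2 : ∀ k ∈ K, ⟪β, k⟫ = c * ⟪β, g.symm k⟫ := fun k hk => by
        rw [← hc1 _ (hK k hk).2, g.apply_symm_apply]
      rcases lt_trichotomy c 0 with h0 | rfl | h0
      · exfalso
        have h1 := hsum β v hv.1
        have h2 := hc2 v hv.1
        rw [hc1 v hv.1] at h1
        set b := ⟪β, g.symm v⟫
        have hb : b < 0 := by
          by_contra hb
          have := mul_nonpos_of_nonpos_of_nonneg h0.le (not_lt.1 hb)
          linarith
        -- Here `μ = c + c⁻¹` with `c < 0`. A top value at most `-2` then forces the isometry `g` to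
        -- be `-1` on `E`.
        have hμ2 : μ ≤ -2 := by
          rw [h2] at h1 hβv
          have h3 : b * (c ^ 2 + 1 - μ * c) = 0 := by linear_combination h1
          have h4 : c ^ 2 + 1 - μ * c = 0 := (mul_eq_zero.1 h3).resolve_left hb.ne
          by_contra hcon
          push Not at hcon
          nlinarith [sq_nonneg (c + 1)]
        refine hne fun x hx => ?_
        have h5 := hμ.le x hx
        rw [symmetrized_apply, inner_add_left] at h5
        have h6 : ⟪g.symm x, x⟫ = ⟪g x, x⟫ := by
          rw [real_inner_comm, inner_symm_right]
        have h7 : ⟪g x + x, g x + x⟫ ≤ 0 := by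
          rw [inner_add_left, inner_add_right, inner_add_right, g.inner_map_map,
            real_inner_comm (g x) x]
          have h8 : 0 ≤ ⟪x, x⟫ := real_inner_self_nonneg
          have := real_inner_comm (g x) x
          nlinarith
        exact eq_neg_of_add_eq_zero_left 
          (inner_self_eq_zero.1 (h7.antisymm real_inner_self_nonneg))
      · have := hc2 v hv.1
        rw [zero_mul] at this
        exact absurd this hβv.ne'
      · refine core ?_ ?_
        · rw [hc1 v hv.1]; positivity
        · have := hc2 v₁ hv₁K
          rw [this] at hβv₁
          by_contra hcon
          exact absurd (mul_nonneg h0.le (not_lt.1 hcon)) hβv₁.not_ge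
    · have h3 : SameSide (g β) v h ∧ SameSide (g β) v v₁ := by
        refine (hall _ hδ).resolve_left ?_
        rintro ⟨c, hc⟩
        have h4 := hc h hhK
        rw [hβh, mul_zero, ← inner_symm_right] at h4
        rw [h4, add_zero, inner_map_right] at hh
        exact h1.ne_right hh
      -- Now `g h` and `g⁻¹ h` lie strictly on opposite sides of `β`, and `v`, `v₁` may replace `h`
      -- in either. The sign decides whether the link is built for `g` or for `g⁻¹`.
      rcases lt_or_gt_of_ne h1.ne_right with h0 | h0
      · refine (core' ?_ ?_).of_symm hn hg
        · rw [inner_symm_right, h3.1.pos_iff, ← inner_symm_right]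
          rw [← inner_map_right] at h0
          linarith
        · rw [inner_map_right, ← h2.neg_iff, h1.neg_iff]
          exact h0
      · refine core ?_ ?_
        · rw [inner_map_right, h1.pos_iff]
          exact h0
        · rw [inner_symm_right, ← h3.2.neg_iff, h3.1.neg_iff, ← inner_symm_right]
          rw [← inner_map_right] at h0
          linarith
  obtain ⟨p', h1, h2⟩ := ih _ (by omega) hp₁ hgood₁ rfl
  exact ⟨p', .head hlink h1, h2⟩

/-! ### Reduction to the hyperplanes containing the eigenspace. -/

/-- The vectors of `Φ` that are orthogonal to `K`. -/
noncomputable def vertical (Φ : Finset V) (K : Submodule ℝ V) : Finset V :=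
  open Classical in Φ.filter fun α => ¬ ∃ k ∈ K, ⟪α, k⟫ ≠ 0

theorem mem_vertical {Φ : Finset V} {K : Submodule ℝ V} {α : V} :
    α ∈ vertical Φ K ↔ α ∈ Φ ∧ ∀ k ∈ K, ⟪α, k⟫ = 0 := by
  simp [vertical]

/-- The vertical count is handled by induction; around a fixed generic point of `K` the transversal
count is constant. -/
theorem gap_vertical_add (Φ : Finset V) (K : Submodule ℝ V) (p q : V) :
    gap Φ p q = gap (vertical Φ K) p q + gap (transversal Φ K) p q := by
  classical
  rw [gap, gap, gap, ← Finset.card_union_of_disjoint]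
  · congr 1
    ext α
    simp only [Finset.mem_union, mem_sep, mem_vertical, mem_transversal]
    by_cases h : ∃ k ∈ K, ⟪α, k⟫ ≠ 0
    · have h' : ¬ ∀ k ∈ K, ⟪α, k⟫ = 0 := by push Not; exact h
      simp [h, h']
    · have h' : ∀ k ∈ K, ⟪α, k⟫ = 0 := by
        intro k hk
        by_contra h'
        exact h ⟨k, hk, h'⟩
      exact ⟨fun ⟨a, b⟩ => Or.inl ⟨⟨a, h'⟩, b⟩, fun hh => hh.elim (fun ⟨⟨a, _⟩, b⟩ => ⟨a, b⟩)
        fun ⟨⟨_, c⟩, _⟩ => absurd c h⟩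
  · rw [Finset.disjoint_left]
    intro α h1 h2
    obtain ⟨k, hk, h⟩ := (mem_transversal.1 (mem_sep.1 h2).1).2
    exact h ((mem_vertical.1 (mem_sep.1 h1).1).2 k hk)

theorem Regular.vertical {Φ : Finset V} {K : Submodule ℝ V} {p : V} (hp : Regular Φ p) :
    Regular (vertical Φ K) p := fun α hα => hp α (mem_vertical.1 hα).1

theorem neg_mem_vertical {Φ : Finset V} (hn : ∀ α ∈ Φ, -α ∈ Φ) {K : Submodule ℝ V} :
    ∀ α ∈ vertical Φ K, -α ∈ vertical Φ K := by
  intro α hα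
  obtain ⟨h1, h2⟩ := mem_vertical.1 hα
  exact mem_vertical.2 ⟨hn α h1, fun k hk => by rw [inner_neg_left, h2 k hk, neg_zero]⟩

theorem map_mem_vertical {Φ : Finset V} {g : V ≃ₗᵢ[ℝ] V} (hg : ∀ α, g α ∈ Φ ↔ α ∈ Φ)
    {K : Submodule ℝ V} (hK : ∀ v ∈ K, g v ∈ K ∧ g.symm v ∈ K) (α : V) :
    g α ∈ vertical Φ K ↔ α ∈ vertical Φ K := by
  rw [mem_vertical, mem_vertical, hg]
  refine and_congr_right fun _ => ⟨fun h k hk => ?_, fun h k hk => ?_⟩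
  · rw [← g.inner_map_map, h _ (hK k hk).1]
  · rw [← inner_symm_right, h _ (hK k hk).2]

section Lift

variable {Φ : Finset V} {K : Submodule ℝ V} {v : V}

theorem gap_goodAt_map {g : V ≃ₗᵢ[ℝ] V} (hg : ∀ α, g α ∈ Φ ↔ α ∈ Φ)
    (hK : ∀ v ∈ K, g v ∈ K ∧ g.symm v ∈ K) {x y x' y' : V}
    (hx : GoodAt Φ K v x) (hx' : GoodAt Φ K v x') (hy : GoodAt Φ K v y) (hy' : GoodAt Φ K v y') :
    gap (transversal Φ K) x (g y) = gap (transversal Φ K) x' (g y') := by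
  have h {a b : V} (ha : GoodAt Φ K v a) (hb : GoodAt Φ K v b) :
      ∀ α ∈ transversal Φ K, SameSide α a b := fun α hα =>
    (ha.2 α (mem_transversal.1 hα).1 (mem_transversal.1 hα).2).symm.trans
      (hb.2 α (mem_transversal.1 hα).1 (mem_transversal.1 hα).2)
  exact gap_congr (h hx hx') fun α hα => (sameSide_map g).2
    (h hy hy' _ ((symm_mem_iff (map_mem_transversal hg hK) α).2 hα))

theorem gap_goodAt {x y : V} (hx : GoodAt Φ K v x) (hy : GoodAt Φ K v y) :
    gap (transversal Φ K) x y = 0 := by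
  rw [gap, Finset.card_eq_zero, Finset.eq_empty_iff_forall_notMem]
  intro α hα
  obtain ⟨h1, h2, h3⟩ := mem_sep.1 hα
  obtain ⟨h4, h5⟩ := mem_transversal.1 h1
  exact absurd ((hy.2 α h4 h5).pos_iff.1 ((hx.2 α h4 h5).pos_iff.2 h2)) h3.not_gt

theorem gap_eq_vertical {x y : V} (hx : GoodAt Φ K v x) (hy : GoodAt Φ K v y) :
    gap Φ x y = gap (vertical Φ K) x y := by
  rw [gap_vertical_add Φ K, gap_goodAt hx hy, add_zero]

/-- A chamber of the vertical arrangement is that of a chamber having `v` in its closure. -/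
theorem exists_lift {x q : V} (hx : GoodAt Φ K v x) (hq : Regular (vertical Φ K) q) :
    ∃ q', Regular Φ q' ∧ GoodAt Φ K v q' ∧ ∀ α ∈ vertical Φ K, SameSide α q q' := by
  obtain ⟨ε, hε, hs⟩ := exists_sameSide Φ v q
  have h1 : GoodAt Φ K v (v + ε • q) :=
    ⟨hx.1, fun α hα hk => hs α hα (hx.2 α hα hk).ne_left⟩
  have h2 : ∀ α ∈ vertical Φ K, SameSide α q (v + ε • q) := by
    intro α hα
    unfold SameSide
    rw [inner_add_right, (mem_vertical.1 hα).2 v hx.1, zero_add, inner_smul_right, mul_left_comm]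
    exact mul_pos hε (mul_self_pos.2 (hq α hα))
  refine ⟨_, fun α hα => ?_, h1, h2⟩
  by_cases hk : ∃ k ∈ K, ⟪α, k⟫ ≠ 0
  · exact (h1.2 α hα hk).ne_right
  · push Not at hk
    exact (h2 α (mem_vertical.2 ⟨hα, hk⟩)).ne_right

/-- Around a generic `v` in `K` every vertical chamber is cut out by a chamber touching `v`, so a
chain can be lifted one move at a time. -/
theorem lift_chain {R R' : V → V → Prop} (hRr : ∀ a b, R' a b → Regular (vertical Φ K) b)
    (hR : ∀ a b a' b', R' a b → Regular Φ a' → Regular Φ b' → GoodAt Φ K v a' →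
      GoodAt Φ K v b' → (∀ α ∈ vertical Φ K, SameSide α a a') →
      (∀ α ∈ vertical Φ K, SameSide α b b') → R a' b') {p q : V} (hp : Regular Φ p)
    (hv : GoodAt Φ K v p) (h : Relation.ReflTransGen R' p q) :
    ∃ q', Relation.ReflTransGen R p q' ∧ Regular Φ q' ∧ GoodAt Φ K v q' ∧
      ∀ α ∈ vertical Φ K, SameSide α q q' := by
  induction h with
  | refl => exact ⟨p, .refl, hp, hv, fun α hα => sameSide_self (hp α (mem_vertical.1 hα).1)⟩
  | tail _ h ih =>
    obtain ⟨b', h1, h2, h3, h4⟩ := ih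
    obtain ⟨c', h5, h6, h7⟩ := exists_lift hv (hRr _ _ h)
    exact ⟨c', h1.tail (hR _ _ _ _ h h2 h5 h3 h6 h4 h7), h5, h6, h7⟩

variable {g : V ≃ₗᵢ[ℝ] V}

theorem gap_vertical_map_congr (hg : ∀ α, g α ∈ Φ ↔ α ∈ Φ)
    (hK : ∀ v ∈ K, g v ∈ K ∧ g.symm v ∈ K) {a b a' b' : V}
    (ha : ∀ α ∈ vertical Φ K, SameSide α a a') (hb : ∀ α ∈ vertical Φ K, SameSide α b b') :
    gap (vertical Φ K) a (g b) = gap (vertical Φ K) a' (g b') :=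
  gap_congr ha fun α hα => (sameSide_map g).2
    (hb _ ((symm_mem_iff (map_mem_vertical hg hK) α).2 hα))

/-- Both displacements change by the same transversal constant, and no transversal hyperplane
separates chambers around `v`. -/
theorem wallStep_lift (hg : ∀ α, g α ∈ Φ ↔ α ∈ Φ)
    (hK : ∀ v ∈ K, g v ∈ K ∧ g.symm v ∈ K) {a b a' b' : V} (h : WallStep (vertical Φ K) g a b)
    (ha : Regular Φ a') (hb : Regular Φ b') (hva : GoodAt Φ K v a') (hvb : GoodAt Φ K v b')
    (hsa : ∀ α ∈ vertical Φ K, SameSide α a a') (hsb : ∀ α ∈ vertical Φ K, SameSide α b b') :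
    WallStep Φ g a' b' := by
  obtain ⟨-, -, h1, h2⟩ := h
  refine ⟨ha, hb, ?_, ?_⟩
  · rwa [gap_eq_vertical hva hvb, ← gap_congr hsa hsb]
  · rw [gap_vertical_add Φ K b', gap_vertical_add Φ K a', gap_goodAt_map hg hK hvb hva hvb hva,
      ← gap_vertical_map_congr hg hK hsa hsa, ← gap_vertical_map_congr hg hK hsb hsb]
    omega

theorem link_lift (hg : ∀ α, g α ∈ Φ ↔ α ∈ Φ)
    (hK : ∀ v ∈ K, g v ∈ K ∧ g.symm v ∈ K) {a b a' b' : V} (h : Link (vertical Φ K) g a b)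
    (ha : Regular Φ a') (hb : Regular Φ b') (hva : GoodAt Φ K v a') (hvb : GoodAt Φ K v b')
    (hsa : ∀ α ∈ vertical Φ K, SameSide α a a') (hsb : ∀ α ∈ vertical Φ K, SameSide α b b') :
    Link Φ g a' b' := by
  have hg' : ∀ α, g.symm α ∈ Φ ↔ α ∈ Φ := symm_mem_iff hg
  have hK' : ∀ v ∈ K, g.symm v ∈ K ∧ g.symm.symm v ∈ K := fun v hv => ⟨(hK v hv).2, (hK v hv).1⟩
  obtain ⟨-, -, h1, h2⟩ := h
  rw [gap_vertical_map_congr hg hK hsa hsa, gap_vertical_map_congr hg hK hsb hsb] at h1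
  rw [gap_congr hsa hsb, gap_vertical_map_congr hg hK hsb hsa, gap_congr hsb hsa,
    gap_vertical_map_congr hg hK hsa hsa, gap_vertical_map_congr hg' hK' hsb hsa,
    gap_vertical_map_congr hg' hK' hsa hsa] at h2
  have e1 := gap_goodAt_map hg hK hvb hva hvb hva
  have e2 := gap_goodAt_map hg hK hvb hva hva hva
  have e3 := gap_goodAt_map hg' hK' hvb hva hva hva
  refine ⟨ha, hb, ?_, ?_⟩
  · rw [gap_vertical_add Φ K b', gap_vertical_add Φ K a', e1, h1]
  · rw [gap_eq_vertical hva hvb, gap_eq_vertical hvb hva, gap_vertical_add Φ K b' (g a'),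
      gap_vertical_add Φ K a' (g a'), gap_vertical_add Φ K b' (g.symm a'),
      gap_vertical_add Φ K a' (g.symm a'), e2, e3]
    omega

end Lift

/-- If `g` acts as `-1` on the span of `Φ`, all chambers are connected by wall steps. -/
theorem reflTransGen_wallStep_of_neg {Φ : Finset V} (hn : ∀ α ∈ Φ, -α ∈ Φ)
    (hr : ∀ α ∈ Φ, ∀ β ∈ Φ, ∀ c : ℝ, α = c • β → α = β ∨ α = -β) {g : V ≃ₗᵢ[ℝ] V}
    (hg : ∀ α, g α ∈ Φ ↔ α ∈ Φ) (hneg : ∀ α ∈ Φ, g α = -α) {p p' : V} (hp : Regular Φ p)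
    (hp' : Regular Φ p') : Relation.ReflTransGen (WallStep Φ g) p p' := by
  -- The origin lies in every closed chamber and on every wall, so this gallery runs all the way to
  -- the chamber of `p'`.
  obtain ⟨q, h1, hq, -, h2⟩ := exists_gallery (v := 0) hn hr p' hp fun _ _ _ => by simp
  refine (Relation.ReflTransGen.mono (fun a b h => ?_) _ _ h1).tail
    (WallStep.of_sameSide hn hg fun α hα => ?_)
  · obtain ⟨ha, hb, -, α, hα, hs, -, -⟩ := h
    refine ⟨ha, hb, by rw [gap, hs, Finset.card_singleton],
      gap_map_le_of_sep_eq_singleton hn hg ha hb hs (Or.inr ?_)⟩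
    have h3 := (mem_sep.1 (hs ▸ Finset.mem_singleton_self α)).2.1
    rw [inner_symm_right, hneg α hα, inner_neg_left]
    linarith
  · rcases lt_or_gt_of_ne (hq α hα) with h3 | h3
    · have := h2 (-α) (hn α hα) (by simp) (by rw [inner_neg_left]; linarith)
      rw [inner_neg_left] at this
      exact mul_pos_of_neg_of_neg h3 (lt_of_le_of_ne (by linarith) (hp' α hα))
    · exact mul_pos h3 (lt_of_le_of_ne (h2 α hα (by simp) h3) (hp' α hα).symm)

/-! ### The induction on the number of roots. -/

/-- For an isometry `g` preserving a finite central hyperplane arrangement, wall steps lead from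
every chamber to one of minimal displacement, and chambers of minimal displacement are linked. -/
theorem minimal_displacement [FiniteDimensional ℝ V] (g : V ≃ₗᵢ[ℝ] V) (Φ : Finset V)
    (hn : ∀ α ∈ Φ, -α ∈ Φ)
    (hr : ∀ α ∈ Φ, ∀ β ∈ Φ, ∀ c : ℝ, α = c • β → α = β ∨ α = -β) (h0 : (0 : V) ∉ Φ)
    (hg : ∀ α, g α ∈ Φ ↔ α ∈ Φ) :
    (∀ p, Regular Φ p → ∃ p', Relation.ReflTransGen (WallStep Φ g) p p' ∧
      ∀ q, Regular Φ q → gap Φ p' (g p') ≤ gap Φ q (g q)) ∧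
    ∀ p p', Regular Φ p → Regular Φ p' →
      (∀ q, Regular Φ q → gap Φ p (g p) ≤ gap Φ q (g q)) →
      (∀ q, Regular Φ q → gap Φ p' (g p') ≤ gap Φ q (g q)) →
      Relation.ReflTransGen (Link Φ g) p p' := by
  induction hk : Φ.card using Nat.strong_induction_on generalizing Φ with
  | _ k ih =>
  set E := Submodule.span ℝ (Φ : Set V) with hE
  have hΦE : ∀ α ∈ Φ, α ∈ E := fun α hα => Submodule.subset_span hα
  by_cases hneg : ∀ x ∈ E, g x = -x
  · have key {p p' : V} (hp : Regular Φ p) (hp' : Regular Φ p') :=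
      reflTransGen_wallStep_of_neg hn hr hg (fun α hα => hneg α (hΦE α hα)) hp hp'
    exact ⟨fun p hp => ⟨p, .refl, fun q hq => reflTransGen_wallStep_le (key hq hp)⟩,
      fun p p' hp hp' hm _ => reflTransGen_link_of_wallStep hm (key hp hp')⟩
  have hgE : ∀ v ∈ E, g v ∈ E ∧ g.symm v ∈ E := by
    intro v hv
    induction hv using Submodule.span_induction with
    | mem x hx => exact ⟨hΦE _ ((hg x).2 hx), hΦE _ ((symm_mem_iff hg x).2 hx)⟩
    | zero => simp
    | add x y _ _ hx hy =>
      rw [map_add, map_add]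
      exact ⟨E.add_mem hx.1 hy.1, E.add_mem hx.2 hy.2⟩
    | smul c x _ hx =>
      rw [map_smul, map_smul]
      exact ⟨E.smul_mem _ hx.1, E.smul_mem _ hx.2⟩
  have hEne : E ≠ ⊥ := by
    intro h
    refine hneg fun x hx => ?_
    rw [h, Submodule.mem_bot] at hx
    simp [hx]
  obtain ⟨μ, hμ, x, hxE, hx0, hTx⟩ := exists_isTop (symmetrized g) (symmetrized_isSymmetric g) E
    (fun v hv => E.add_mem (hgE v hv).1 (hgE v hv).2) hEne
  set K := eigenpart g E μ with hKdef
  have hK : ∀ v ∈ K, g v ∈ K ∧ g.symm v ∈ K := fun v hv => eigenpart_map hgE hv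
  have hxK : x ∈ K := mem_eigenpart.2 ⟨hxE, hTx⟩
  -- A nonzero vector of `K`, which lies in the span of the roots, cannot be orthogonal to all of
  -- them.
  have hcard : (vertical Φ K).card < k := by
    rw [← hk]
    refine Finset.card_lt_card ((Finset.ssubset_iff_of_subset
      fun α hα => (mem_vertical.1 hα).1).2 ?_)
    by_contra hcon
    push Not at hcon
    have hE0 : E ≤ LinearMap.ker (innerₗ V x) := by
      rw [hE, Submodule.span_le]
      intro α hα
      rw [SetLike.mem_coe, LinearMap.mem_ker, innerₗ_apply_apply, real_inner_comm]
      exact (mem_vertical.1 (hcon α hα)).2 x hxK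
    exact hx0 (inner_self_eq_zero.1 (hE0 hxE))
  have ihK := ih _ hcard (vertical Φ K) (neg_mem_vertical hn)
    (fun α hα β hβ => hr α (mem_vertical.1 hα).1 β (mem_vertical.1 hβ).1)
    (fun h => h0 (mem_vertical.1 h).1) (map_mem_vertical hg hK) rfl
  have reach {p : V} (hp : Regular Φ p) : ∃ p', Relation.ReflTransGen (WallStep Φ g) p p' ∧
      Regular Φ p' ∧ ∃ v, GoodAt Φ K v p' := by
    obtain ⟨p', h1, v, hv⟩ := exists_goodAt hn hr hg hgE hΦE hμ hp
    exact ⟨p', h1, reflTransGen_wallStep_regular hp h1, v, hv⟩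
  have cross {p v v' p' : V} (hp : Regular Φ p) (hv : GoodAt Φ K v p) (hv' : GoodAt Φ K v' p') :
      ∃ p₁, Relation.ReflTransGen (Link Φ g) p p₁ ∧ Regular Φ p₁ ∧ GoodAt Φ K v' p₁ :=
    exists_link_goodAt hn hg hgE hμ hneg hp hv hv'.1 fun α hα =>
      (hv'.2 α (mem_transversal.1 hα).1 (mem_transversal.1 hα).2).ne_left
  have compare {v a b : V} (ha : GoodAt Φ K v a) (hb : GoodAt Φ K v b) :
      gap Φ a (g a) ≤ gap Φ b (g b) ↔
        gap (vertical Φ K) a (g a) ≤ gap (vertical Φ K) b (g b) := by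
    rw [gap_vertical_add Φ K a, gap_vertical_add Φ K b, gap_goodAt_map hg hK ha hb ha hb]
    omega
  constructor
  · intro p hp
    obtain ⟨p₁, h1, hp₁, v, hv⟩ := reach hp
    obtain ⟨p₂, h2, h3⟩ := ihK.1 p₁ hp₁.vertical
    obtain ⟨p₃, h4, hp₃, hv₃, h5⟩ := lift_chain (R := WallStep Φ g) (fun a b h => h.2.1)
      (fun a b a' b' => wallStep_lift hg hK) hp₁ hv h2
    refine ⟨p₃, h1.trans h4, fun q hq => ?_⟩
    -- Steps and links, neither raising displacement, bring any competitor to a chamber around the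
    -- same `v`, where vertical minimality decides.
    obtain ⟨q₁, h6, hq₁, w, hw⟩ := reach hq
    obtain ⟨q₂, h7, hq₂, hw₂⟩ := cross hq₁ hw hv₃
    refine le_trans ?_ ((reflTransGen_link_eq h7).le.trans (reflTransGen_wallStep_le h6))
    rw [compare hv₃ hw₂, ← gap_vertical_map_congr hg hK h5 h5]
    exact h3 _ hq₂.vertical
  · intro p p' hp hp' hm hm'
    obtain ⟨p₁, h1, hp₁, v, hv⟩ := reach hp
    obtain ⟨p₁', h1', hp₁', v', hv'⟩ := reach hp'
    obtain ⟨p₂, h2, hp₂, hv₂⟩ := cross hp₁ hv hv'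
    have hL := (reflTransGen_link_of_wallStep hm h1).trans h2
    have hL' := reflTransGen_link_of_wallStep hm' h1'
    have e := reflTransGen_link_eq hL
    have e' := reflTransGen_link_eq hL'
    have hmin {a : V} (ha : GoodAt Φ K v' a) (hma : ∀ q, Regular Φ q → gap Φ a (g a) ≤ gap Φ q (g q))
        (q : V) (hq : Regular (vertical Φ K) q) :
        gap (vertical Φ K) a (g a) ≤ gap (vertical Φ K) q (g q) := by
      obtain ⟨q', hq', hv'', hs⟩ := exists_lift ha hq
      rw [gap_vertical_map_congr hg hK hs hs, ← compare ha hv'']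
      exact hma q' hq'
    have h3 := ihK.2 p₂ p₁' hp₂.vertical hp₁'.vertical
      (hmin hv₂ fun q hq => e.le.trans (hm q hq)) (hmin hv' fun q hq => e'.le.trans (hm' q hq))
    obtain ⟨p₃, h4, hp₃, hv₃, h5⟩ := lift_chain (R := Link Φ g) (fun a b h => h.2.1)
      (fun a b a' b' => link_lift hg hK) hp₂ hv₂ h3
    have h6 : Link Φ g p₃ p₁' := by
      refine ⟨hp₃, hp₁', ?_, Or.inl ?_⟩
      · rw [reflTransGen_link_eq h4, e, e']
        exact le_antisymm (hm p' hp') (hm' p hp)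
      · rw [gap_eq_vertical hv₃ hv', (gap_eq_zero_iff (neg_mem_vertical hn) hp₃.vertical
          hp₁'.vertical).2 fun α hα => (h5 α hα).symm]
        exact zero_le_one
    exact ((hL.trans h4).tail h6).trans (link_symmetric hn hg hL')

end Arrangement

/-! ### The geometric representation and positivity of roots. -/

namespace CoxeterSystem

open Real

section Form

variable {B : Type*} (M : CoxeterMatrix B)

/-- The simple root of index `i` in the geometric representation. -/
noncomputable def root (i : B) : B →₀ ℝ := Finsupp.single i 1

/-- The bilinear form of the geometric representation, normalized so that simple roots have
square `2`. -/
noncomputable def form : (B →₀ ℝ) →ₗ[ℝ] (B →₀ ℝ) →ₗ[ℝ] ℝ :=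
  Finsupp.linearCombination ℝ fun i =>
    Finsupp.linearCombination ℝ fun j => -2 * cos (π / M i j)

theorem form_root_root (i j : B) : form M (root i) (root j) = -2 * cos (π / M i j) := by
  simp [form, root]

theorem form_root_self (i : B) : form M (root i) (root i) = 2 := by
  simp [form_root_root]

theorem form_comm (x y : B →₀ ℝ) : form M x y = form M y x := by
  have : form M = (form M).flip := by
    ext i j
    have := form_root_root M i j
    rw [M.symmetric, ← form_root_root] at this
    simpa [root] using this
  conv_lhs => rw [this]
  rfl

/-- The reflection of the geometric representation in the simple root of index `i`. -/
noncomputable def refl (i : B) : (B →₀ ℝ) ≃ₗ[ℝ] (B →₀ ℝ) :=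
  Module.reflection (form_root_self M i)

theorem refl_apply (i : B) (x : B →₀ ℝ) : refl M i x = x - form M (root i) x • root i :=
  Module.reflection_apply x (form_root_self M i)

theorem refl_refl (i : B) (x : B →₀ ℝ) : refl M i (refl M i x) = x := by
  rw [refl_apply, refl_apply, map_sub, map_smul, form_root_self]
  simp only [smul_eq_mul]
  module

theorem form_refl_refl (i : B) (x y : B →₀ ℝ) :
    form M (refl M i x) (refl M i y) = form M x y := by
  simp only [refl_apply, map_sub, map_smul, LinearMap.sub_apply, LinearMap.smul_apply,
    smul_eq_mul, form_root_self, form_comm M x (root i)]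
  ring

variable {M}

/-- The coefficients of the roots in the rank two subsystem spanned by `i` and `j`. -/
structure IsDihedralCoeff (M : CoxeterMatrix B) (i j : B) (c : ℕ → ℝ) : Prop where
  zero : c 0 = 0
  one : c 1 = 1
  add_two : ∀ k, c (k + 2) = 2 * cos (π / M i j) * c (k + 1) - c k

theorem isDihedralCoeff_of_eq_zero {i j : B} (h : M i j = 0) :
    IsDihedralCoeff M i j fun k => k := by
  refine ⟨by simp, by simp, fun k => ?_⟩
  simp only [h, Nat.cast_zero, div_zero, cos_zero]
  push_cast
  ring

theorem sin_pi_div_pos {m : ℕ} (hm : 2 ≤ m) : 0 < sin (π / m) := by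
  have : (2 : ℝ) ≤ m := by exact_mod_cast hm
  refine sin_pos_of_pos_of_lt_pi (by positivity) ?_
  rw [div_lt_iff₀ (by positivity)]
  nlinarith [pi_pos]

theorem isDihedralCoeff_sin {i j : B} (h : 2 ≤ M i j) :
    IsDihedralCoeff M i j fun k => sin (k * (π / M i j)) / sin (π / M i j) := by
  have hs := (sin_pi_div_pos h).ne'
  refine ⟨by simp, by simp [hs], fun k => ?_⟩
  generalize π / M i j = θ at hs ⊢
  push_cast
  field_simp
  rw [show (k + 2 : ℝ) * θ = (k + 1) * θ + θ by ring, show (k : ℝ) * θ = (k + 1) * θ - θ by ring,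
    sin_add, sin_sub]
  ring_nf

theorem two_le_or_eq_zero {i j : B} (h : i ≠ j) : M i j = 0 ∨ 2 ≤ M i j := by
  have := M.off_diagonal i j h
  omega

theorem refl_combination (i j : B) (a b : ℝ) :
    refl M i (a • root i + b • root j) =
      (2 * cos (π / M i j) * b - a) • root i + b • root j := by
  rw [refl_apply, map_add, map_smul, map_smul, form_root_self, form_root_root]
  simp only [smul_eq_mul]
  module

theorem refl_mul_refl_pow_root {i j : B} {c : ℕ → ℝ} (hc : IsDihedralCoeff M i j c) (k : ℕ) :
    ((refl M i * refl M j) ^ k) (root i) = c (2 * k + 1) • root i + c (2 * k) • root j := by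
  induction k with
  | zero => simp [hc.zero, hc.one]
  | succ k ih =>
    rw [pow_succ', LinearEquiv.mul_apply, ih, LinearEquiv.mul_apply, add_comm, refl_combination,
      add_comm, refl_combination, M.symmetric j i, ← hc.add_two, ← hc.add_two]
    rfl

/-- The product of the two reflections rotates the plane of the roots by `2π / M i j`, or acts as a
shear when `M i j = 0`. -/
theorem dvd_of_refl_mul_refl_pow_root {i j : B} (hij : i ≠ j) {k : ℕ}
    (h : ((refl M i * refl M j) ^ k) (root i) = root i) : M i j ∣ k := by
  have key : ∀ c, IsDihedralCoeff M i j c → c (2 * k + 1) = 1 ∧ c (2 * k) = 0 := by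
    intro c hc
    rw [refl_mul_refl_pow_root hc] at h
    have h1 := DFunLike.congr_fun h i
    have h2 := DFunLike.congr_fun h j
    simp [root, hij, hij.symm] at h1 h2
    exact ⟨h1, h2⟩
  rcases two_le_or_eq_zero hij with h0 | h2
  · have := (key _ (isDihedralCoeff_of_eq_zero h0)).2
    have hk : 2 * k = 0 := by exact_mod_cast this
    have hk : k = 0 := by omega
    simp [hk]
  · obtain ⟨h1, h3⟩ := key _ (isDihedralCoeff_sin h2)
    have hs := (sin_pi_div_pos h2).ne'
    push_cast at h1 h3
    rw [div_eq_zero_iff, or_iff_left hs] at h3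
    rw [div_eq_one_iff_eq hs, add_mul, one_mul, sin_add, h3, zero_mul, zero_add] at h1
    have h4 : cos (2 * k * (π / M i j)) = 1 := by
      have : (cos (2 * k * (π / M i j)) - 1) * sin (π / M i j) = 0 := by linear_combination h1
      linarith [(mul_eq_zero.1 this).resolve_right hs]
    obtain ⟨n, hn⟩ := (cos_eq_one_iff _).1 h4
    have hm : (M i j : ℝ) ≠ 0 := by
      have : M i j ≠ 0 := by omega
      exact_mod_cast this
    have h5 : (n : ℝ) * M i j = k := by
      field_simp at hn
      exact hn
    have h6 : (M i j : ℤ) ∣ k := ⟨n, by rw [mul_comm]; exact_mod_cast h5.symm⟩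
    exact_mod_cast h6

theorem refl_mul_refl_pow_root_eq {i j : B} (h : 2 ≤ M i j) :
    ((refl M i * refl M j) ^ M i j) (root i) = root i := by
  have hs := (sin_pi_div_pos h).ne'
  have hm : (M i j : ℝ) ≠ 0 := by
    have : M i j ≠ 0 := by omega
    exact_mod_cast this
  rw [refl_mul_refl_pow_root (isDihedralCoeff_sin h)]
  have h1 : ((2 * M i j : ℕ) : ℝ) * (π / M i j) = 2 * π := by
    push_cast; field_simp
  have h2 : ((2 * M i j + 1 : ℕ) : ℝ) * (π / M i j) = π / M i j + 2 * π := by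
    push_cast; field_simp; ring
  simp only [h1, h2, sin_add_two_pi, sin_two_pi, div_self hs]
  simp

theorem refl_fixes {x : B →₀ ℝ} {i : B} (h : form M (root i) x = 0) : refl M i x = x := by
  rw [refl_apply, h]; simp

/-- The power fixes both simple roots and everything orthogonal to them. The form is nondegenerate
on their plane when `2 ≤ M i j`, so these vectors span. -/
theorem isLiftable_refl : M.IsLiftable (refl M) := by
  intro i j
  by_cases hij : i = j
  · subst hij
    rw [M.diagonal, pow_one]
    ext1 x
    exact refl_refl M i x
  rcases two_le_or_eq_zero (M := M) hij with h0 | h2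
  · rw [h0, pow_zero]
  set g := (refl M i * refl M j) ^ M i j with hg
  have hi : g (root i) = root i := refl_mul_refl_pow_root_eq h2
  have hj : g (root j) = root j := by
    have h3 := refl_mul_refl_pow_root_eq (M := M) (i := j) (j := i) (by rwa [M.symmetric j i])
    rw [M.symmetric j i] at h3
    have h4 : g * (refl M j * refl M i) ^ M i j = 1 := by
      have e : refl M j * refl M i = (refl M i * refl M j)⁻¹ := by
        rw [eq_inv_iff_mul_eq_one]
        ext1 x
        simp only [LinearEquiv.mul_apply, LinearEquiv.coe_one, id, refl_refl]
      rw [hg, e, inv_pow, mul_inv_cancel]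
    have h5 := LinearEquiv.congr_fun h4 (root j)
    rw [LinearEquiv.mul_apply, h3] at h5
    simpa using h5
  have hfix : ∀ y : B →₀ ℝ, form M (root i) y = 0 → form M (root j) y = 0 → g y = y := by
    intro y h3 h4
    have h5 : (refl M i * refl M j) y = y := by
      rw [LinearEquiv.mul_apply, refl_fixes h4, refl_fixes h3]
    rw [hg]
    generalize M i j = n
    induction n with
    | zero => simp
    | succ n ih => rw [pow_succ', LinearEquiv.mul_apply, ih, h5]
  ext1 x
  set C := cos (π / M i j) with hC
  have hS := sin_pi_div_pos h2
  have hS2 : sin (π / M i j) ^ 2 = 1 - C ^ 2 := by rw [sin_sq]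
  have hD : 1 - C ^ 2 ≠ 0 := by rw [← hS2]; positivity
  set p := form M (root i) x
  set q := form M (root j) x
  -- `a` and `b` are the coordinates of the orthogonal projection of `x` to the plane, from the Gram
  -- system `2a - 2Cb = p`, `2b - 2Ca = q`.
  set a := (p + C * q) / (2 * (1 - C ^ 2)) with ha
  set b := (q + C * p) / (2 * (1 - C ^ 2)) with hb
  have h3 := hfix (x - (a • root i + b • root j)) (by
    simp only [map_sub, map_add, map_smul, smul_eq_mul, form_root_self, form_root_root]
    change p - (a * 2 + b * (-2 * C)) = 0
    rw [ha, hb]; field_simp; ring) (by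
    simp only [map_sub, map_add, map_smul, smul_eq_mul, form_root_self, form_root_root,
      M.symmetric j i]
    change q - (a * (-2 * C) + b * 2) = 0
    rw [ha, hb]; field_simp; ring)
  rw [map_sub, map_add, map_smul, map_smul, hi, hj] at h3
  simpa using h3

end Form

variable {B W : Type*} [Group W] {M : CoxeterMatrix B} (cs : CoxeterSystem M W)

/-- The geometric representation of a Coxeter group. -/
noncomputable def geom : W →* (B →₀ ℝ) ≃ₗ[ℝ] (B →₀ ℝ) := cs.lift ⟨refl M, isLiftable_refl⟩

theorem geom_simple (i : B) : cs.geom (cs.simple i) = refl M i :=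
  cs.lift_apply_simple isLiftable_refl i

theorem form_geom (w : W) (x y : B →₀ ℝ) :
    form M (cs.geom w x) (cs.geom w y) = form M x y := by
  induction w using cs.simple_induction_left generalizing x y with
  | one => simp
  | mul_simple_left w i ih =>
    rw [map_mul, LinearEquiv.mul_apply, LinearEquiv.mul_apply, geom_simple, form_refl_refl, ih]

/-- The order of `s i * s j` is `M i j`. -/
theorem orderOf_simple_mul_simple (i j : B) : orderOf (cs.simple i * cs.simple j) = M i j := by
  by_cases hij : i = j
  · subst hij; simp
  refine Nat.dvd_antisymm (orderOf_dvd_of_pow_eq_one (cs.simple_mul_simple_pow i j)) ?_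
  refine dvd_of_refl_mul_refl_pow_root hij ?_
  have := congrArg cs.geom (pow_orderOf_eq_one (cs.simple i * cs.simple j))
  rw [map_pow, map_mul, geom_simple, geom_simple, map_one] at this
  rw [this]; rfl

theorem simple_injective : Function.Injective cs.simple := by
  intro i j h
  by_contra hij
  have := cs.orderOf_simple_mul_simple i j
  rw [← h, cs.simple_mul_simple_self, orderOf_one] at this
  exact M.off_diagonal i j hij this.symm

theorem geom_alternatingWord_root {i j : B} {c : ℕ → ℝ} (hc : IsDihedralCoeff M i j c) (k : ℕ) :
    cs.geom (cs.wordProd (alternatingWord i j k)) (root i) =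
      if Even k then c (k + 1) • root i + c k • root j else c k • root i + c (k + 1) • root j := by
  induction k with
  | zero => simp [alternatingWord, hc.zero, hc.one]
  | succ k ih =>
    rw [alternatingWord_succ', wordProd_cons, map_mul, LinearEquiv.mul_apply, ih, geom_simple]
    by_cases hk : Even k
    · rw [if_pos hk, if_pos hk, if_neg (by simpa [Nat.even_add_one] using hk), add_comm,
        refl_combination, M.symmetric j i, ← hc.add_two, add_comm]
    · rw [if_neg hk, if_neg hk, if_pos (by simpa [Nat.even_add_one] using hk),
        refl_combination, ← hc.add_two]

theorem exists_dihedralCoeff_nonneg {i j : B} (hij : i ≠ j) :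
    ∃ c, IsDihedralCoeff M i j c ∧ ∀ k, M i j = 0 ∨ k ≤ M i j → 0 ≤ c k := by
  rcases two_le_or_eq_zero (M := M) hij with h0 | h2
  · exact ⟨_, isDihedralCoeff_of_eq_zero h0, fun k _ => Nat.cast_nonneg k⟩
  · refine ⟨_, isDihedralCoeff_sin h2, fun k hk => div_nonneg ?_ (sin_pi_div_pos h2).le⟩
    have hk : k ≤ M i j := hk.resolve_left (by omega)
    have hm : (0 : ℝ) < M i j := by
      have : 0 < M i j := by omega
      exact_mod_cast this
    refine sin_nonneg_of_nonneg_of_le_pi (by positivity) ?_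
    have : (k : ℝ) ≤ M i j := by exact_mod_cast hk
    rw [mul_div_assoc', div_le_iff₀ hm, mul_comm]
    gcongr

/-- Strip from the right of `w` as many alternating letters, starting with `j`, as possible. -/
theorem exists_mul_alternatingWord (i j : B) (w : W) (h : cs.IsRightDescent w j) :
    ∃ v : W, ∃ k : ℕ, 0 < k ∧ w = v * cs.wordProd (alternatingWord i j k) ∧
      cs.length w = cs.length v + k ∧ ¬ cs.IsRightDescent v i ∧ ¬ cs.IsRightDescent v j := by
  induction hn : cs.length w using Nat.strong_induction_on generalizing i j w with
  | _ n ih =>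
  rw [cs.isRightDescent_iff] at h
  have hj : ¬ cs.IsRightDescent (w * cs.simple j) j := by
    rw [cs.not_isRightDescent_iff]
    simp [h]
  by_cases hi : cs.IsRightDescent (w * cs.simple j) i
  · obtain ⟨v, k, -, h1, h2, h3, h4⟩ := ih _ (by omega) j i _ hi rfl
    refine ⟨v, k + 1, k.succ_pos, ?_, by omega, h4, h3⟩
    rw [alternatingWord_succ, wordProd_concat, ← mul_assoc, ← h1]
    simp
  · refine ⟨w * cs.simple j, 1, one_pos, ?_, by omega, hi, hj⟩
    simp [alternatingWord]

/-- If `w s_i` is longer than `w`, then `w` sends the simple root of index `i` to a nonnegative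
vector. -/
theorem geom_root_nonneg {w : W} {i : B} (h : ¬ cs.IsRightDescent w i) :
    0 ≤ cs.geom w (root i) := by
  induction hn : cs.length w using Nat.strong_induction_on generalizing i w with
  | _ n ih =>
  have hpos (i : B) : (0 : B →₀ ℝ) ≤ root i := Finsupp.single_nonneg.2 zero_le_one
  by_cases hw : w = 1
  · subst hw; simpa using hpos i
  obtain ⟨j, hj⟩ := cs.exists_rightDescent_of_ne_one hw
  have hij : i ≠ j := by rintro rfl; exact h hj
  -- By induction `v` makes both simple roots nonnegative, while the alternating factor sends the
  -- root of `i` to a combination with coefficients `c k` and `c (k + 1)`.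
  obtain ⟨v, k, hk, rfl, hlen, hvi, hvj⟩ := cs.exists_mul_alternatingWord i j w hj
  obtain ⟨c, hc, hc0⟩ := exists_dihedralCoeff_nonneg (M := M) hij
  -- Otherwise the alternating word of length `k + 1` is not reduced, and `i` would be a right
  -- descent.
  have hkM : M i j = 0 ∨ k + 1 ≤ M i j := by
    by_contra hcon
    push Not at hcon
    obtain ⟨h0, hlt⟩ := hcon
    refine h ?_
    have e : cs.wordProd (alternatingWord i j k) * cs.simple i =
        cs.wordProd (alternatingWord j i (k + 1)) := by
      rw [alternatingWord_succ, wordProd_concat]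
    have hle := cs.length_mul_le v (cs.wordProd (alternatingWord j i (k + 1)))
    have hlt' : cs.length (cs.wordProd (alternatingWord j i (k + 1))) < k + 1 := by
      have h1 := cs.length_wordProd_le (alternatingWord j i (k + 1))
      rw [length_alternatingWord] at h1
      refine lt_of_le_of_ne h1 fun h2 => ?_
      refine cs.not_isReduced_alternatingWord j i (m := k + 1) ?_ ?_ ?_
      · rwa [M.symmetric j i]
      · rw [M.symmetric j i]; omega
      · rw [IsReduced, length_alternatingWord, h2]
    have hne := cs.length_mul_simple_ne (v * cs.wordProd (alternatingWord i j k)) i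
    rw [IsRightDescent]
    rw [mul_assoc, e] at hne ⊢
    omega
  have h1 := ih (cs.length v) (by omega) hvi rfl
  have h2 := ih (cs.length v) (by omega) hvj rfl
  have h3 := hc0 k (by omega)
  have h4 := hc0 (k + 1) hkM
  rw [map_mul, LinearEquiv.mul_apply, cs.geom_alternatingWord_root hc]
  split_ifs <;>
  · rw [map_add, map_smul, map_smul]
    exact add_nonneg (smul_nonneg (by assumption) (by assumption))
      (smul_nonneg (by assumption) (by assumption))

theorem geom_root_nonpos {w : W} {i : B} (h : cs.IsRightDescent w i) :
    cs.geom w (root i) ≤ 0 := by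
  have h1 := cs.geom_root_nonneg ((cs.isRightDescent_iff_not_isRightDescent_mul).1 h)
  rw [map_mul, LinearEquiv.mul_apply, geom_simple, refl_apply, form_root_self] at h1
  have h2 : root i - (2 : ℝ) • root i = -root i := by module
  rw [h2, map_neg] at h1
  exact neg_nonneg.1 h1

/-- A root that is nonnegative and becomes nonpositive under `s i` is the `i`-th simple root. -/
theorem geom_root_eq_root {x : B →₀ ℝ} {i : B} (hx : form M x x = 2) (h0 : 0 ≤ x)
    (h1 : refl M i x ≤ 0) : x = root i := by
  have h2 : x = x i • root i := by
    ext k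
    by_cases hk : k = i
    · subst hk; simp [root]
    · have h3 : refl M i x k ≤ 0 := h1 k
      have h4 : 0 ≤ x k := h0 k
      have h5 : root i k = 0 := Finsupp.single_eq_of_ne hk
      rw [refl_apply, Finsupp.sub_apply, Finsupp.smul_apply, h5, smul_zero, sub_zero] at h3
      rw [Finsupp.smul_apply, h5, smul_zero]
      exact le_antisymm h3 h4
  have h3 : 0 ≤ x i := h0 i
  rw [h2] at hx
  simp only [map_smul, LinearMap.smul_apply, form_root_self, smul_eq_mul] at hx
  have h4 : x i = 1 := by nlinarith
  rw [h2, h4, one_smul]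

/-- If multiplying `x` by `s i` on the left or by `s j` on the right increases the length, but doing
both does not, then `s i * x = x * s j`. -/
theorem simple_mul_eq_mul_simple {x : W} {i j : B} (h1 : ¬ cs.IsRightDescent x j)
    (h2 : cs.IsRightDescent (cs.simple i * x) j) : cs.simple i * x = x * cs.simple j := by
  have h3 : cs.geom x (root j) = root i := by
    refine geom_root_eq_root (M := M) ?_ (cs.geom_root_nonneg h1) ?_
    · rw [form_geom, form_root_self]
    · have := cs.geom_root_nonpos h2
      rwa [map_mul, LinearEquiv.mul_apply, geom_simple] at this
  have h4 : cs.geom (cs.simple i * x) = cs.geom (x * cs.simple j) := by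
    ext1 y
    rw [map_mul, map_mul, LinearEquiv.mul_apply, LinearEquiv.mul_apply, geom_simple, geom_simple,
      refl_apply, refl_apply, map_sub, map_smul, h3, ← cs.form_geom x (root j), h3]
  -- A nontrivial element has a right descent and sends that positive root to a nonpositive vector,
  -- so it cannot act trivially.
  have inj : Function.Injective cs.geom := by
    rw [injective_iff_map_eq_one]
    intro w hw
    by_contra hw1
    obtain ⟨k, hk⟩ := cs.exists_rightDescent_of_ne_one hw1
    have h5 := cs.geom_root_nonpos hk
    rw [hw] at h5
    have h6 := h5 k
    simp [root] at h6
    linarith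
  exact inj h4

end CoxeterSystem

/-! ### The extended group acting on roots. -/

namespace TwistedCoxeter

open CoxeterSystem Arrangement

variable {B : Type*} {M : CoxeterMatrix B} {W : Type*} [Group W]
  {cs : CoxeterSystem M W} {δ : MulAut W}

/-- Finiteness makes every power of `δ` a nonnegative one, so inverses also preserve the simple
reflections. -/
theorem IsDiagramAut.of_mem_zpowers [Finite W] (hδ : IsDiagramAut cs δ) {γ : MulAut W}
    (hγ : γ ∈ Subgroup.zpowers δ) : IsDiagramAut cs γ := by
  have : Finite (MulAut W) := DFunLike.finite _
  rw [← (isOfFinOrder_of_finite δ).mem_powers_iff_mem_zpowers] at hγ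
  obtain ⟨n, rfl⟩ := hγ
  induction n with
  | zero => exact fun i => ⟨i, by simp⟩
  | succ n ih =>
    intro i
    obtain ⟨j, hj⟩ := hδ i
    obtain ⟨k, hk⟩ := ih j
    exact ⟨k, by simpa [pow_succ, hj] using hk⟩

section Action

variable [Finite W] (hδ : IsDiagramAut cs δ)

/-- The permutations of the simple reflections given by the powers of `δ`. -/
noncomputable def diagramPerm : Subgroup.zpowers δ →* Equiv.Perm B :=
  MonoidHom.toHomPerm
    { toFun := fun γ i => (hδ.of_mem_zpowers γ.2 i).choose
      map_one' := by
        funext i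
        refine cs.simple_injective ?_
        rw [← (hδ.of_mem_zpowers (1 : Subgroup.zpowers δ).2 i).choose_spec]
        rfl
      map_mul' := fun γ γ' => by
        funext i
        refine cs.simple_injective ?_
        change _ = cs.simple (hδ.of_mem_zpowers γ.2 (hδ.of_mem_zpowers γ'.2 i).choose).choose
        rw [← (hδ.of_mem_zpowers (γ * γ').2 i).choose_spec,
          ← (hδ.of_mem_zpowers γ.2 _).choose_spec, ← (hδ.of_mem_zpowers γ'.2 i).choose_spec]
        rfl }

theorem apply_simple (γ : Subgroup.zpowers δ) (i : B) :
    (γ : MulAut W) (cs.simple i) = cs.simple (diagramPerm hδ γ i) :=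
  (hδ.of_mem_zpowers γ.2 i).choose_spec

/-- An automorphism preserves the order of a product of two simple reflections, which is the matrix
entry. Hence the permutation preserves the form. -/
theorem matrix_diagramPerm (γ : Subgroup.zpowers δ) (i j : B) :
    M (diagramPerm hδ γ i) (diagramPerm hδ γ j) = M i j := by
  rw [← cs.orderOf_simple_mul_simple, ← cs.orderOf_simple_mul_simple, ← apply_simple,
    ← apply_simple, ← map_mul]
  exact MulEquiv.orderOf_eq (γ : MulAut W) _

/-- The powers of `δ` permute the coordinates of the geometric representation. -/
noncomputable def diagramAction : Subgroup.zpowers δ →* (B →₀ ℝ) ≃ₗ[ℝ] (B →₀ ℝ) where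
  toFun γ := Finsupp.domLCongr (diagramPerm hδ γ)
  map_one' := by
    ext1 x
    ext i
    simp only [map_one]
    rfl
  map_mul' γ γ' := by
    ext1 x
    ext i
    simp only [map_mul]
    rfl

theorem diagramAction_root (γ : Subgroup.zpowers δ) (i : B) :
    diagramAction hδ γ (root i) = root (diagramPerm hδ γ i) := by
  simp [diagramAction, root]

theorem form_diagramAction (γ : Subgroup.zpowers δ) (x y : B →₀ ℝ) :
    form M (diagramAction hδ γ x) (diagramAction hδ γ y) = form M x y := by
  have : (form M).compl₁₂ (diagramAction hδ γ).toLinearMap (diagramAction hδ γ).toLinearMap =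
      form M := by
    ext i j
    have h := form_root_root M (diagramPerm hδ γ i) (diagramPerm hδ γ j)
    rw [matrix_diagramPerm, ← form_root_root M i j, ← diagramAction_root, ← diagramAction_root] at h
    exact h
  exact LinearMap.congr_fun₂ this x y

/-- The geometric representation of `⟨δ⟩ ⋉ W`. -/
noncomputable def action : Ext δ →* (B →₀ ℝ) ≃ₗ[ℝ] (B →₀ ℝ) :=
  SemidirectProduct.lift cs.geom (diagramAction hδ) fun γ => by
    refine cs.ext_simple fun i => ?_
    have h1 : ((MulEquiv.toMonoidHom ((Subgroup.zpowers δ).subtype γ)) (cs.simple i) : W) =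
        cs.simple (diagramPerm hδ γ i) := apply_simple hδ γ i
    rw [MonoidHom.comp_apply, h1, geom_simple]
    change _ = diagramAction hδ γ * cs.geom (cs.simple i) * (diagramAction hδ γ)⁻¹
    rw [eq_mul_inv_iff_mul_eq, geom_simple]
    ext1 x
    rw [LinearEquiv.mul_apply, LinearEquiv.mul_apply, refl_apply, refl_apply, map_sub, map_smul,
      diagramAction_root, ← diagramAction_root, form_diagramAction]

theorem action_inl (w : W) : action hδ (SemidirectProduct.inl w) = cs.geom w :=
  SemidirectProduct.lift_inl ..

theorem action_inr (γ : Subgroup.zpowers δ) :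
    action hδ (SemidirectProduct.inr γ) = diagramAction hδ γ :=
  SemidirectProduct.lift_inr ..

theorem action_eq (g : Ext δ) (x : B →₀ ℝ) :
    action hδ g x = cs.geom g.left (diagramAction hδ g.right x) := by
  conv_lhs => rw [← SemidirectProduct.inl_left_mul_inr_right g]
  rw [map_mul, LinearEquiv.mul_apply, action_inl, action_inr]

theorem form_action (g : Ext δ) (x y : B →₀ ℝ) :
    form M (action hδ g x) (action hδ g y) = form M x y := by
  rw [action_eq, action_eq, form_geom, form_diagramAction]

/-- A root of the geometric representation of `⟨δ⟩ ⋉ W`. -/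
def IsRoot (x : B →₀ ℝ) : Prop := ∃ (g : Ext δ) (i : B), x = action hδ g (root i)

variable {hδ}

theorem IsRoot.action {x : B →₀ ℝ} (hx : IsRoot hδ x) (g : Ext δ) :
    IsRoot hδ (action hδ g x) := by
  obtain ⟨h, i, rfl⟩ := hx
  exact ⟨g * h, i, by rw [map_mul]; rfl⟩

theorem isRoot_root (i : B) : IsRoot hδ (root i) := ⟨1, i, by simp⟩

theorem IsRoot.neg {x : B →₀ ℝ} (hx : IsRoot hδ x) : IsRoot hδ (-x) := by
  obtain ⟨g, i, rfl⟩ := hx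
  refine ⟨g * SemidirectProduct.inl (cs.simple i), i, ?_⟩
  rw [map_mul, LinearEquiv.mul_apply, action_inl, geom_simple, refl_apply, form_root_self, ← map_neg]
  congr 1
  module

theorem IsRoot.form_self {x : B →₀ ℝ} (hx : IsRoot hδ x) : form M x x = 2 := by
  obtain ⟨g, i, rfl⟩ := hx
  rw [form_action, form_root_self]

theorem IsRoot.ne_zero {x : B →₀ ℝ} (hx : IsRoot hδ x) : x ≠ 0 := by
  rintro rfl
  simpa using hx.form_self

theorem IsRoot.nonneg_or_nonpos {x : B →₀ ℝ} (hx : IsRoot hδ x) : 0 ≤ x ∨ x ≤ 0 := by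
  obtain ⟨g, i, rfl⟩ := hx
  rw [action_eq, diagramAction_root]
  by_cases h : cs.IsRightDescent g.left (diagramPerm hδ g.right i)
  · exact Or.inr (cs.geom_root_nonpos h)
  · exact Or.inl (cs.geom_root_nonneg h)

end Action

/-! ### Euclidean realization: chambers and lengths. -/

section Realization

variable [Fintype B] [Fintype (Ext δ)]

/-- The Euclidean space in which the geometric representation is realized isometrically. -/
abbrev Ambient (B : Type*) {W : Type*} [Group W] (δ : MulAut W) : Type _ :=
  EuclideanSpace ℝ (Ext δ × B)

/-- `⟨δ⟩ ⋉ W` permutes the coordinates of the ambient space. -/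
noncomputable def translate (h : Ext δ) : Ambient B δ ≃ₗᵢ[ℝ] Ambient B δ :=
  LinearIsometryEquiv.piLpCongrLeft 2 ℝ ℝ ((Equiv.mulRight h⁻¹).prodCongr (Equiv.refl B))

theorem translate_apply (h g : Ext δ) (v : Ambient B δ) (b : B) :
    translate h v (g, b) = v (g * h, b) := by
  simp [translate, LinearIsometryEquiv.piLpCongrLeft_apply, Equiv.piCongrLeft']

theorem translate_mul (h k : Ext δ) (v : Ambient B δ) :
    translate (h * k) v = translate h (translate k v) := by
  ext ⟨g, b⟩
  simp only [translate_apply, mul_assoc]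

theorem translate_one (v : Ambient B δ) : translate 1 v = v := by
  ext ⟨g, b⟩
  rw [translate_apply, mul_one]

theorem translate_symm (h : Ext δ) (v : Ambient B δ) :
    (translate h).symm v = translate h⁻¹ v := by
  rw [LinearIsometryEquiv.symm_apply_eq, ← translate_mul, mul_inv_cancel, translate_one]

/-- The vector whose coordinates are `1` at the neutral element and `0` elsewhere. -/
noncomputable def basepoint (B : Type*) [Fintype B] (δ : MulAut W) [Fintype (Ext δ)] :
    Ambient B δ :=
  open Classical in WithLp.toLp 2 fun p => if p.1 = 1 then 1 else 0

variable [Finite W] (hδ : IsDiagramAut cs δ)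

/-- The equivariant embedding of the geometric representation in the ambient space. -/
noncomputable def embed : (B →₀ ℝ) →ₗ[ℝ] Ambient B δ where
  toFun x := WithLp.toLp 2 fun p => action hδ p.1 x p.2
  map_add' x y := by ext p; simp
  map_smul' c x := by ext p; simp

omit [Fintype B] [Fintype (Ext δ)] in
theorem embed_apply (x : B →₀ ℝ) (g : Ext δ) (b : B) :
    embed hδ x (g, b) = action hδ g x b := rfl

theorem embed_action (h : Ext δ) (x : B →₀ ℝ) :
    embed hδ (action hδ h x) = translate h (embed hδ x) := by
  ext ⟨g, b⟩
  rw [translate_apply, embed_apply, embed_apply, map_mul, LinearEquiv.mul_apply]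

omit [Fintype B] [Fintype (Ext δ)] in
theorem embed_injective : Function.Injective (embed hδ) := by
  intro x y h
  ext b
  have := congrArg (fun v : Ambient B δ => v (1, b)) h
  simpa [embed_apply] using this

/-- Pairing with the basepoint is the height function, which is positive exactly on positive roots;
this places the basepoint in the fundamental chamber. -/
theorem inner_embed_basepoint (x : B →₀ ℝ) : ⟪embed hδ x, basepoint B δ⟫ = ∑ b, x b := by
  classical
  rw [PiLp.inner_apply, Fintype.sum_prod_type, Finset.sum_eq_single 1]
  · simp [basepoint, embed_apply]
  · intro g _ hg
    simp [basepoint, hg]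
  · simp

theorem inner_embed_translate (h : Ext δ) (x : B →₀ ℝ) (v : Ambient B δ) :
    ⟪embed hδ x, translate h v⟫ = ⟪embed hδ (action hδ h⁻¹ x), v⟫ := by
  rw [embed_action, inner_map_right, translate_symm]

/-- The embedded roots. -/
noncomputable def roots : Finset (Ambient B δ) :=
  (Set.finite_range fun p : Ext δ × B => embed hδ (action hδ p.1 (root p.2))).toFinset

theorem mem_roots {v : Ambient B δ} :
    v ∈ roots hδ ↔ ∃ x, IsRoot hδ x ∧ v = embed hδ x := by
  simp only [roots, Set.Finite.mem_toFinset, Set.mem_range, Prod.exists]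
  constructor
  · rintro ⟨g, i, rfl⟩
    exact ⟨_, ⟨g, i, rfl⟩, rfl⟩
  · rintro ⟨x, ⟨g, i, rfl⟩, rfl⟩
    exact ⟨g, i, rfl⟩

theorem neg_mem_roots : ∀ v ∈ roots hδ, -v ∈ roots hδ := by
  intro v hv
  obtain ⟨x, hx, rfl⟩ := (mem_roots hδ).1 hv
  exact (mem_roots hδ).2 ⟨-x, hx.neg, (map_neg _ _).symm⟩

theorem zero_notMem_roots : (0 : Ambient B δ) ∉ roots hδ := by
  intro h
  obtain ⟨x, hx, h⟩ := (mem_roots hδ).1 h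
  exact hx.ne_zero (embed_injective hδ (by rw [← h, map_zero]))

theorem roots_reduced : ∀ v ∈ roots hδ, ∀ w ∈ roots hδ, ∀ c : ℝ, v = c • w → v = w ∨ v = -w := by
  intro v hv w hw c h
  obtain ⟨x, hx, rfl⟩ := (mem_roots hδ).1 hv
  obtain ⟨y, hy, rfl⟩ := (mem_roots hδ).1 hw
  rw [← map_smul] at h
  have h1 := embed_injective hδ h
  have h2 := hx.form_self
  rw [h1] at h2
  simp only [map_smul, LinearMap.smul_apply, smul_eq_mul, hy.form_self] at h2
  have h3 : c ^ 2 = 1 := by linarith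
  rcases sq_eq_one_iff.1 h3 with rfl | rfl
  · left; rw [h1, one_smul]
  · right; rw [h1, neg_one_smul, map_neg]

theorem translate_mem_roots (h : Ext δ) (v : Ambient B δ) :
    translate h v ∈ roots hδ ↔ v ∈ roots hδ := by
  have key (h : Ext δ) (v : Ambient B δ) (hv : v ∈ roots hδ) : translate h v ∈ roots hδ := by
    obtain ⟨x, hx, rfl⟩ := (mem_roots hδ).1 hv
    exact (mem_roots hδ).2 ⟨_, hx.action h, (embed_action hδ h x).symm⟩
  refine ⟨fun hv => ?_, key h v⟩
  have := key h⁻¹ _ hv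
  rwa [← translate_mul, inv_mul_cancel, translate_one] at this

variable {hδ}

theorem IsRoot.inner_basepoint_pos_iff {x : B →₀ ℝ} (hx : IsRoot hδ x) :
    0 < ⟪embed hδ x, basepoint B δ⟫ ↔ 0 ≤ x := by
  have key {x : B →₀ ℝ} (hx : IsRoot hδ x) (h : 0 ≤ x) : 0 < ∑ b, x b := by
    obtain ⟨b, hb⟩ := Finsupp.ne_iff.1 hx.ne_zero
    exact Finset.sum_pos' (fun b _ => h b) ⟨b, Finset.mem_univ b, lt_of_le_of_ne (h b) hb.symm⟩
  rw [inner_embed_basepoint]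
  refine ⟨fun h => hx.nonneg_or_nonpos.resolve_right fun h' => ?_, key hx⟩
  have := key hx.neg (neg_nonneg.2 h')
  simp only [Finsupp.neg_apply, Finset.sum_neg_distrib] at this
  linarith

theorem IsRoot.inner_basepoint_neg_iff {x : B →₀ ℝ} (hx : IsRoot hδ x) :
    ⟪embed hδ x, basepoint B δ⟫ < 0 ↔ x ≤ 0 := by
  rw [← neg_nonneg, ← hx.neg.inner_basepoint_pos_iff, map_neg, inner_neg_left, neg_pos]

variable (hδ)

theorem regular_basepoint : Regular (roots hδ) (basepoint B δ) := by
  intro v hv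
  obtain ⟨x, hx, rfl⟩ := (mem_roots hδ).1 hv
  rcases hx.nonneg_or_nonpos with h | h
  · exact (hx.inner_basepoint_pos_iff.2 h).ne'
  · exact (hx.inner_basepoint_neg_iff.2 h).ne

theorem regular_translate (h : Ext δ) : Regular (roots hδ) (translate h (basepoint B δ)) :=
  (regular_basepoint hδ).map (translate_mem_roots hδ h)

theorem gap_translate (h : Ext δ) (p q : Ambient B δ) :
    gap (roots hδ) (translate h p) (translate h q) = gap (roots hδ) p q :=
  gap_map _ (translate_mem_roots hδ h) p q

theorem sep_basepoint_simple (i : B) :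
    sep (roots hδ) (basepoint B δ) (translate (incl δ (cs.simple i)) (basepoint B δ)) =
      {embed hδ (root i)} := by
  have hact (x : B →₀ ℝ) : action hδ (incl δ (cs.simple i))⁻¹ x = refl M i x := by
    rw [← map_inv, cs.inv_simple, action_inl, geom_simple]
  ext v
  rw [mem_sep, Finset.mem_singleton]
  constructor
  · rintro ⟨hv, h1, h2⟩
    obtain ⟨x, hx, rfl⟩ := (mem_roots hδ).1 hv
    rw [hx.inner_basepoint_pos_iff] at h1
    rw [inner_embed_translate, (hx.action _).inner_basepoint_neg_iff, hact] at h2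
    rw [geom_root_eq_root hx.form_self h1 h2]
  · rintro rfl
    have h0 : (0 : B →₀ ℝ) ≤ root i := Finsupp.single_nonneg.2 zero_le_one
    refine ⟨(mem_roots hδ).2 ⟨_, isRoot_root i, rfl⟩,
      (isRoot_root i).inner_basepoint_pos_iff.2 h0, ?_⟩
    rw [inner_embed_translate, ((isRoot_root i).action _).inner_basepoint_neg_iff, hact,
      refl_apply, form_root_self]
    have : root i - (2 : ℝ) • root i = -root i := by module
    rw [this]
    exact neg_nonpos.2 h0

theorem gap_basepoint_simple (i : B) :
    gap (roots hδ) (basepoint B δ) (translate (incl δ (cs.simple i)) (basepoint B δ)) = 1 := by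
  rw [gap, sep_basepoint_simple, Finset.card_singleton]

/-- Only the root `w α_i` changes sign between the chambers of `w` and `w s_i`; it is positive at
the basepoint because `i` is not a descent. -/
theorem gap_basepoint_mul_simple {w : W} {i : B} (h : ¬ cs.IsRightDescent w i) :
    gap (roots hδ) (basepoint B δ) (translate (incl δ (w * cs.simple i)) (basepoint B δ)) =
      gap (roots hδ) (basepoint B δ) (translate (incl δ w) (basepoint B δ)) + 1 := by
  have hn := neg_mem_roots hδ
  have h1 := gap_eq_add_of_neg hn (q := basepoint B δ)
    (regular_translate hδ (incl δ (w * cs.simple i))) (regular_translate hδ (incl δ w)) (by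
      intro β hβ
      obtain ⟨x, hx, rfl⟩ := (mem_roots hδ).1 (mem_sep.1 hβ).1
      have h2 := mem_sep.1 (neg_mem_sep hn hβ)
      rw [← map_neg, map_mul, translate_mul, inner_embed_translate, inner_embed_translate hδ _ (-x)]
        at h2
      have h3 := sep_basepoint_simple hδ i ▸
        mem_sep.2 ⟨(mem_roots hδ).2 ⟨_, hx.neg.action _, rfl⟩, h2.2⟩
      have h4 := embed_injective hδ (Finset.mem_singleton.1 h3)
      have h5 : -x = cs.geom w (root i) := by
        rw [← h4, ← action_inl hδ, ← LinearEquiv.mul_apply, ← map_mul, mul_inv_cancel, map_one]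
        rfl
      rw [hx.inner_basepoint_neg_iff, ← neg_nonneg, h5]
      exact cs.geom_root_nonneg h)
  rw [gap_comm hn, h1, map_mul, translate_mul, gap_translate, gap_comm hn, gap_basepoint_simple,
    gap_comm hn, add_comm]

theorem gap_basepoint_incl (w : W) :
    gap (roots hδ) (basepoint B δ) (translate (incl δ w) (basepoint B δ)) = cs.length w := by
  induction w using cs.simple_induction_right with
  | one =>
    rw [map_one, translate_one, cs.length_one, gap_eq_zero_iff (neg_mem_roots hδ)
      (regular_basepoint hδ) (regular_basepoint hδ)]
    exact fun α hα => sameSide_self (regular_basepoint hδ α hα)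
  | mul_simple_right w i ih =>
    by_cases h : cs.IsRightDescent w i
    · have h1 := gap_basepoint_mul_simple hδ (cs.isRightDescent_iff_not_isRightDescent_mul.1 h)
      rw [cs.simple_mul_simple_cancel_right, ih] at h1
      rw [cs.isRightDescent_iff] at h
      omega
    · rw [gap_basepoint_mul_simple hδ h, ih, cs.not_isRightDescent_iff.1 h]

/-- A diagram automorphism permutes coordinates, so it preserves heights and fixes the fundamental
chamber. -/
theorem sameSide_inr (γ : Subgroup.zpowers δ) :
    ∀ α ∈ roots hδ, SameSide α (translate (SemidirectProduct.inr γ) (basepoint B δ))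
      (basepoint B δ) := by
  intro α hα
  have h := regular_basepoint hδ α hα
  obtain ⟨x, hx, rfl⟩ := (mem_roots hδ).1 hα
  have : ⟪embed hδ x, translate (SemidirectProduct.inr γ) (basepoint B δ)⟫ =
      ⟪embed hδ x, basepoint B δ⟫ := by
    rw [inner_embed_translate, inner_embed_basepoint, inner_embed_basepoint, ← map_inv, action_inr]
    simp only [diagramAction, MonoidHom.coe_mk, OneHom.coe_mk, Finsupp.domLCongr_apply,
      Finsupp.domCongr_apply, Finsupp.equivMapDomain_apply]
    exact Equiv.sum_comp _ _
  unfold SameSide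
  rw [this]
  exact mul_self_pos.2 h

theorem gap_basepoint_eq_len (w : Ext δ) :
    gap (roots hδ) (basepoint B δ) (translate w (basepoint B δ)) = len cs w := by
  obtain ⟨γ, v, rfl⟩ : ∃ γ v, w = SemidirectProduct.inr γ * SemidirectProduct.inl v := by
    refine ⟨w.right, ((SemidirectProduct.inr w.right)⁻¹ * w).left, ?_⟩
    rw [← inv_mul_eq_iff_eq_mul]
    ext <;> simp
  have h := gap_congr (Φ := roots hδ)
    (fun α hα => (sameSide_inr hδ γ α hα).symm) (fun α hα => sameSide_self
      (regular_translate hδ (SemidirectProduct.inr γ * SemidirectProduct.inl v) α hα))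
  rw [len_inr_mul_inl, h, translate_mul, gap_translate]
  exact gap_basepoint_incl hδ v

/-- The left component is `γ v γ⁻¹` when the element is `γ v`; its length is that of `v` since `γ`
preserves the fundamental chamber. -/
theorem len_eq_length_left (hδ : IsDiagramAut cs δ) (w : Ext δ) : len cs w = cs.length w.left := by
  have h : gap (roots hδ) (basepoint B δ)
      (translate (incl δ w.left) (translate (SemidirectProduct.inr w.right) (basepoint B δ))) =
      gap (roots hδ) (basepoint B δ) (translate (incl δ w.left) (basepoint B δ)) := by
    refine gap_congr (fun α hα => sameSide_self (regular_basepoint hδ α hα)) fun α hα => ?_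
    rw [sameSide_map]
    exact sameSide_inr hδ w.right _ ((symm_mem_iff (translate_mem_roots hδ _) α).2 hα)
  rw [← translate_mul, SemidirectProduct.inl_left_mul_inr_right, gap_basepoint_eq_len,
    gap_basepoint_incl] at h
  exact h

theorem gap_translate_basepoint (a b : W) (w : Ext δ) :
    gap (roots hδ) (translate (incl δ a) (basepoint B δ))
      (translate w (translate (incl δ b) (basepoint B δ))) =
      len cs ((incl δ a)⁻¹ * w * incl δ b) := by
  rw [← gap_basepoint_eq_len hδ, ← gap_translate hδ (incl δ a)⁻¹, ← translate_mul,
    inv_mul_cancel, translate_one, ← translate_mul, ← translate_mul, mul_assoc]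

theorem gap_translate_translate (a b : W) :
    gap (roots hδ) (translate (incl δ a) (basepoint B δ)) (translate (incl δ b) (basepoint B δ)) =
      cs.length (a⁻¹ * b) := by
  rw [← gap_basepoint_incl hδ, ← gap_translate hδ (incl δ a)⁻¹, ← translate_mul,
    inv_mul_cancel, translate_one, ← translate_mul, map_mul, map_inv]

/-- Every chamber is a translate of the fundamental chamber by an element of `W`. -/
theorem exists_sameSide_translate {p : Ambient B δ} (hp : Regular (roots hδ) p) :
    ∃ x : W, ∀ α ∈ roots hδ, SameSide α (translate (incl δ x) (basepoint B δ)) p := by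
  obtain ⟨x, hx⟩ := Finite.exists_min fun x : W =>
    gap (roots hδ) (translate (incl δ x) (basepoint B δ)) p
  set q := translate (incl δ x)⁻¹ p with hq
  have hpq : p = translate (incl δ x) q := by
    rw [hq, ← translate_mul, mul_inv_cancel, translate_one]
  have hqr : Regular (roots hδ) q := hp.map (translate_mem_roots hδ _)
  -- A simple root negative at `q` would make the chamber of `x s_i` closer to `p`, against the
  -- choice of `x`.
  have hroot (i : B) : 0 < ⟪embed hδ (root i), q⟫ := by
    by_contra hcon
    have hneg : ⟪embed hδ (root i), q⟫ < 0 := lt_of_le_of_ne (not_lt.1 hcon)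
      (hqr _ ((mem_roots hδ).2 ⟨_, isRoot_root i, rfl⟩))
    have h1 := gap_eq_add_of_neg (neg_mem_roots hδ) (q := q) (regular_basepoint hδ)
      (regular_translate hδ (incl δ (cs.simple i))) (by
        intro β hβ
        rw [sep_basepoint_simple, Finset.mem_singleton] at hβ
        rwa [hβ])
    have h2 := hx (x * cs.simple i)
    rw [hpq, map_mul, translate_mul, gap_translate, gap_translate] at h2
    rw [gap_basepoint_simple] at h1
    omega
  have hpos {y : B →₀ ℝ} (hy : IsRoot hδ y) (h0 : 0 ≤ y) : 0 < ⟪embed hδ y, q⟫ := by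
    refine lt_of_le_of_ne ?_ (hqr _ ((mem_roots hδ).2 ⟨_, hy, rfl⟩)).symm
    have : y = y.sum fun i a => a • root i := by simp [root]
    rw [this, map_finsuppSum, Finsupp.sum, sum_inner]
    refine Finset.sum_nonneg fun i _ => ?_
    rw [map_smul, inner_smul_left]
    exact mul_nonneg (h0 i) (hroot i).le
  have hss : ∀ α ∈ roots hδ, SameSide α (basepoint B δ) q := by
    intro α hα
    obtain ⟨y, hy, rfl⟩ := (mem_roots hδ).1 hα
    rcases hy.nonneg_or_nonpos with h | h
    · exact mul_pos (hy.inner_basepoint_pos_iff.2 h) (hpos hy h)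
    · have := hpos hy.neg (neg_nonneg.2 h)
      rw [map_neg, inner_neg_left, neg_pos] at this
      exact mul_pos_of_neg_of_neg (hy.inner_basepoint_neg_iff.2 h) this
  refine ⟨x, fun α hα => ?_⟩
  rw [hpq, sameSide_map]
  exact hss _ ((symm_mem_iff (translate_mem_roots hδ _) α).2 hα)

end Realization

end TwistedCoxeter

/-! ### From chambers back to conjugates. -/

namespace TwistedCoxeter

open CoxeterSystem Arrangement

variable {B : Type*} {M : CoxeterMatrix B} {W : Type*} [Group W]
  {cs : CoxeterSystem M W} {δ : MulAut W}

theorem incl_simple_inv (i : B) : (incl δ (cs.simple i))⁻¹ = incl δ (cs.simple i) := by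
  rw [← map_inv, cs.inv_simple]

variable [Fintype B] [Fintype (Ext δ)] [Finite W] (hδ : IsDiagramAut cs δ)

/-- The conjugate of `w` attached to the chamber of index `x`. -/
def conj (w : Ext δ) (x : W) : Ext δ := (incl δ x)⁻¹ * w * incl δ x

omit [Fintype B] [Fintype (Ext δ)] [Finite W] in
theorem conj_mul (w : Ext δ) (x y : W) :
    conj w (x * y) = (incl δ y)⁻¹ * conj w x * incl δ y := by
  simp [conj, mul_assoc]

omit [Fintype B] [Fintype (Ext δ)] [Finite W] in
theorem ElemStrongConj.refl (w : Ext δ) : ElemStrongConj cs w w :=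
  ⟨rfl, 1, by simp, by simp⟩

/-- Conjugation by a simple reflection that preserves the length is a strong conjugation. -/
theorem elemStrongConj_simple (hδ : IsDiagramAut cs δ) (w : Ext δ) (i : B)
    (h : len cs (incl δ (cs.simple i) * w * incl δ (cs.simple i)) = len cs w) :
    ElemStrongConj cs w (incl δ (cs.simple i) * w * incl δ (cs.simple i)) := by
  set j := diagramPerm hδ w.right i with hj
  have e1 : (incl δ (cs.simple i) * w).left = cs.simple i * w.left := by simp
  have hr : ((w.right : Subgroup.zpowers δ) : MulAut W) (cs.simple i) = cs.simple j :=
    apply_simple hδ w.right i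
  have e2 : (w * incl δ (cs.simple i)).left = w.left * cs.simple j := by
    simp [hr]
  have e3 : (incl δ (cs.simple i) * w * incl δ (cs.simple i)).left =
      cs.simple i * w.left * cs.simple j := by
    simp [hr, mul_assoc]
  have hl := len_eq_length_left hδ
  refine ⟨h.symm, ?_⟩
  rw [hl, hl w, e3] at h
  rcases cs.length_simple_mul w.left i with h1 | h1
  · refine ⟨cs.simple i, by rw [incl_simple_inv], Or.inl ?_⟩
    rw [hl, hl w, e1, h1, cs.length_simple, add_comm]
  rcases cs.length_mul_simple w.left j with h2 | h2
  · refine ⟨cs.simple i, by rw [incl_simple_inv], Or.inr ?_⟩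
    rw [incl_simple_inv, hl, hl w, e2, h2, cs.length_simple, add_comm]
  -- Both one-sided products are now shorter while the two-sided one has equal length; the exchange
  -- relation shows that the conjugation fixes `w`.
  have h3 := cs.simple_mul_eq_mul_simple (x := cs.simple i * w.left) (i := i) (j := j)
    (by rw [cs.not_isRightDescent_iff]; omega)
    (by rw [cs.simple_mul_simple_cancel_left, cs.isRightDescent_iff]; omega)
  rw [cs.simple_mul_simple_cancel_left] at h3
  have h4 : incl δ (cs.simple i) * w * incl δ (cs.simple i) = w := by
    ext
    · rw [e3, ← h3]
    · simp
  rw [h4]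
  exact ⟨1, by simp, by simp⟩

theorem exists_eq_simple_of_gap_le_one (hδ : IsDiagramAut cs δ) {x y : W}
    (h : gap (roots hδ) (translate (incl δ x) (basepoint B δ))
      (translate (incl δ y) (basepoint B δ)) ≤ 1) :
    y = x ∨ ∃ i, y = x * cs.simple i := by
  rw [gap_translate_translate] at h
  rcases Nat.le_one_iff_eq_zero_or_eq_one.1 h with h | h
  · rw [cs.length_eq_zero_iff, inv_mul_eq_one] at h
    exact Or.inl h.symm
  · obtain ⟨i, hi⟩ := cs.length_eq_one_iff.1 h
    exact Or.inr ⟨i, by rw [← hi, mul_inv_cancel_left]⟩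

/-- `p` lies in the chamber of index `x`. -/
def InChamber (x : W) (p : Ambient B δ) : Prop :=
  ∀ α ∈ roots hδ, SameSide α (translate (incl δ x) (basepoint B δ)) p

variable {hδ}

theorem InChamber.gap_eq {x y : W} {p q : Ambient B δ} (hx : InChamber hδ x p)
    (hy : InChamber hδ y q) :
    gap (roots hδ) p q = gap (roots hδ) (translate (incl δ x) (basepoint B δ))
      (translate (incl δ y) (basepoint B δ)) := (gap_congr hx hy).symm

theorem InChamber.gap_translate {x y : W} {p q : Ambient B δ} (hx : InChamber hδ x p)
    (hy : InChamber hδ y q) (w : Ext δ) :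
    gap (roots hδ) p (translate w q) = len cs ((incl δ x)⁻¹ * w * incl δ y) := by
  rw [← gap_translate_basepoint]
  refine (gap_congr hx fun α hα => ?_).symm
  rw [sameSide_map]
  exact hy _ ((symm_mem_iff (translate_mem_roots hδ _) α).2 hα)

theorem InChamber.gap_self {x : W} {p : Ambient B δ} (hx : InChamber hδ x p) (w : Ext δ) :
    gap (roots hδ) p (translate w p) = len cs (conj w x) := hx.gap_translate hx w

theorem InChamber.conj_eq_of_gap_le_one {x y : W} {p q : Ambient B δ} (hx : InChamber hδ x p)
    (hy : InChamber hδ y q) (h : gap (roots hδ) p q ≤ 1) (w : Ext δ) :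
    conj w y = conj w x ∨
      ∃ i, conj w y = incl δ (cs.simple i) * conj w x * incl δ (cs.simple i) := by
  rw [hx.gap_eq hy] at h
  rcases exists_eq_simple_of_gap_le_one hδ h with rfl | ⟨i, rfl⟩
  · exact Or.inl rfl
  · exact Or.inr ⟨i, by rw [conj_mul, incl_simple_inv]⟩

theorem reduces_of_wallStep {w : Ext δ} {x : W} {p p' : Ambient B δ} (hx : InChamber hδ x p)
    (h : Relation.ReflTransGen (WallStep (roots hδ) (translate w)) p p') :
    ∃ y, InChamber hδ y p' ∧ Reduces cs (conj w x) (conj w y) := by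
  induction h with
  | refl => exact ⟨x, hx, .refl⟩
  | tail _ h ih =>
    obtain ⟨y, hy, hr⟩ := ih
    obtain ⟨-, hq, h1, h2⟩ := h
    obtain ⟨z, hz⟩ := exists_sameSide_translate hδ hq
    replace hz : InChamber hδ z _ := hz
    refine ⟨z, hz, ?_⟩
    rw [hz.gap_self, hy.gap_self] at h2
    rcases hy.conj_eq_of_gap_le_one hz h1 w with h3 | ⟨i, h3⟩
    · rwa [h3]
    · exact hr.tail ⟨i, h3, h2⟩

/-- The conjugating element is `z⁻¹ y`, whose length is the gap between the chambers. The two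
geodesic conditions become the two length additivity conditions; adjacent chambers give a simple
conjugation. -/
theorem elemStrongConj_of_link {w : Ext δ} {y z : W} {p q : Ambient B δ}
    (hy : InChamber hδ y p) (hz : InChamber hδ z q)
    (h : Link (roots hδ) (translate w) p q) : ElemStrongConj cs (conj w y) (conj w z) := by
  obtain ⟨-, -, h1, h2⟩ := h
  rw [translate_symm, hz.gap_translate hy, hy.gap_self] at h2
  rw [hz.gap_self, hy.gap_self] at h1
  have e : incl δ (z⁻¹ * y) * conj w y = (incl δ z)⁻¹ * w * incl δ y := by
    simp [conj, mul_assoc]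
  have e' : conj w z = incl δ (z⁻¹ * y) * conj w y * (incl δ (z⁻¹ * y))⁻¹ := by
    simp [conj, mul_assoc]
  rcases h2 with h2 | h2 | h2
  · rcases hy.conj_eq_of_gap_le_one hz h2 w with h3 | ⟨i, h3⟩
    · rw [h3]; exact .refl _
    · rw [h3] at h1 ⊢
      exact elemStrongConj_simple hδ _ i h1.symm
  · rw [hz.gap_eq hy, gap_translate_translate] at h2
    exact ⟨h1, _, e', Or.inl (by rw [e, h2])⟩
  · refine ⟨h1, _, e', Or.inr ?_⟩
    have a (r s : Ambient B δ) :
        gap (roots hδ) r (translate w⁻¹ s) = gap (roots hδ) s (translate w r) := by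
      rw [← TwistedCoxeter.gap_translate hδ w, ← translate_mul, mul_inv_cancel, translate_one,
        gap_comm (neg_mem_roots hδ)]
    rw [a, a, hy.gap_translate hz, hz.gap_eq hy, gap_translate_translate, hy.gap_self] at h2
    rw [← h2]
    simp [conj, mul_assoc]

theorem strongConj_of_link {w : Ext δ} {x : W} {p p' : Ambient B δ} (hx : InChamber hδ x p)
    (h : Relation.ReflTransGen (Link (roots hδ) (translate w)) p p') :
    ∃ y, InChamber hδ y p' ∧ StrongConj cs (conj w x) (conj w y) := by
  induction h with
  | refl => exact ⟨x, hx, .refl⟩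
  | tail _ h ih =>
    obtain ⟨y, hy, hr⟩ := ih
    obtain ⟨z, hz⟩ := exists_sameSide_translate hδ h.2.1
    exact ⟨z, hz, hr.tail (elemStrongConj_of_link hy hz h)⟩

variable (hδ)

theorem inChamber_translate (x : W) :
    InChamber hδ x (translate (incl δ x) (basepoint B δ)) :=
  fun α hα => sameSide_self (regular_translate hδ _ α hα)

/-- The theorem of He and Nie on elements of minimal length in twisted conjugacy classes. -/
theorem reduces_and_strongConj {B : Type*} {M : CoxeterMatrix B} {W : Type*} [Group W] [Finite W]
    (cs : CoxeterSystem M W) (δ : MulAut W) (hδ : IsDiagramAut cs δ)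
    (O : Set (Ext δ)) (hO : IsWConjClass O) :
    (∀ w ∈ O, ∃ w' ∈ minLength cs O, Reduces cs w w') ∧
    (∀ w ∈ minLength cs O, ∀ w' ∈ minLength cs O,
      StrongConj cs w w') := by
  have : Finite B := Finite.of_injective cs.simple cs.simple_injective
  have : Finite (MulAut W) := DFunLike.finite _
  have : Finite (Ext δ) := Finite.of_equiv _ SemidirectProduct.equivProd.symm
  have := Fintype.ofFinite B
  have := Fintype.ofFinite (Ext δ)
  obtain ⟨w, rfl⟩ := hO
  have hmem (x : W) : conj w x ∈ {y | ∃ x : W, y = incl δ x * w * (incl δ x)⁻¹} :=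
    ⟨x⁻¹, by simp [conj]⟩
  have hconj {u : Ext δ} (hu : u ∈ {y | ∃ x : W, y = incl δ x * w * (incl δ x)⁻¹}) :
      ∃ x, u = conj w x := by
    obtain ⟨x, rfl⟩ := hu
    exact ⟨x⁻¹, by simp [conj]⟩
  have hlen (x : W) := (inChamber_translate hδ x).gap_self w
  obtain ⟨h1, h2⟩ := minimal_displacement (translate w) (roots hδ) (neg_mem_roots hδ)
    (roots_reduced hδ) (zero_notMem_roots hδ) (translate_mem_roots hδ w)
  constructor
  · intro u hu
    obtain ⟨x, rfl⟩ := hconj hu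
    obtain ⟨p, hp, hmin⟩ := h1 _ (regular_translate hδ (incl δ x))
    obtain ⟨y, hy, hr⟩ := reduces_of_wallStep (inChamber_translate hδ x) hp
    refine ⟨_, ⟨hmem y, fun u hu => ?_⟩, hr⟩
    obtain ⟨z, rfl⟩ := hconj hu
    rw [← hy.gap_self, ← hlen]
    exact hmin _ (regular_translate hδ _)
  · have hmin (x : W)
        (hx : conj w x ∈ minLength cs {y | ∃ x : W, y = incl δ x * w * (incl δ x)⁻¹})
        (q : Ambient B δ) (hq : Regular (roots hδ) q) :
        gap (roots hδ) (translate (incl δ x) (basepoint B δ))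
          (translate w (translate (incl δ x) (basepoint B δ))) ≤
          gap (roots hδ) q (translate w q) := by
      obtain ⟨z, hz⟩ := exists_sameSide_translate hδ hq
      rw [hlen, InChamber.gap_self hz]
      exact hx.2 _ (hmem z)
    intro u hu u' hu'
    obtain ⟨x, rfl⟩ := hconj hu.1
    obtain ⟨x', rfl⟩ := hconj hu'.1
    have h3 := h2 _ _ (regular_translate hδ (incl δ x)) (regular_translate hδ (incl δ x'))
      (hmin x hu) (hmin x' hu')
    obtain ⟨y, hy, hs⟩ := strongConj_of_link (inChamber_translate hδ x) h3
    -- A chamber has only one index in `W`, so the chain ends at the required conjugate.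
    have h4 := (gap_eq_zero_iff (neg_mem_roots hδ) (regular_translate hδ _)
      (regular_translate hδ _)).2 hy
    rw [gap_translate_translate, cs.length_eq_zero_iff, inv_mul_eq_one] at h4
    rwa [h4] at hs

end TwistedCoxeter

theorem mainTheorem1 {B : Type*} {M : CoxeterMatrix B} {W : Type*} [Group W] [Finite W]
    (cs : CoxeterSystem M W) (δ : MulAut W) (hδ : TwistedCoxeter.IsDiagramAut cs δ)
    (O : Set (TwistedCoxeter.Ext δ)) (hO : TwistedCoxeter.IsWConjClass O) :
    (∀ w ∈ O, ∃ w' ∈ TwistedCoxeter.minLength cs O, TwistedCoxeter.Reduces cs w w') ∧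
    (∀ w ∈ TwistedCoxeter.minLength cs O, ∀ w' ∈ TwistedCoxeter.minLength cs O,
      TwistedCoxeter.StrongConj cs w w') :=
  TwistedCoxeter.reduces_and_strongConj cs δ hδ O hO
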